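/- Let $N\ge 1$ be an integer, $s\in(0,1)$, and let $2^*_s=\frac{2N}{N-2s}$ if $2s<N$ and $2^*_s=+\infty$ otherwise. Let $q\in(1,2^*_s)$. For an open set $\Omega\subset\mathbb R^N$ let $\mathcal D^{s,2}_0(\Omega)$ be the completion of $C^\infty_0(\Omega)$ with respect to the norm whose square is $$\int_{\mathbb R^N}\int_{\mathbb R^N}\frac{(u(x)-u(y))^2}{|x-y|^{N+2s}}\,dx\,dy ,$$ and let $\mathfrak S(\Omega,s,q)$ be the set of the critical values of this double integral along $\{u\in\mathcal D^{s,2}_0(\Omega):\int_\Omega|u|^q\,dx=1\}$. A $q$-semilinear $s$-eigenfunction corresponding to $\lambda\in\mathfrak S(\Omega,s,q)$ is a $u\in\mathcal D^{s,2}_0(\Omega)$, $u\ne0$, such that $$\int_{\mathbb R^N}\int_{\mathbb R^N}\frac{(u(x)-u(y))(\varphi(x)-\varphi(y))}{|x-y|^{N+2s}}\,dx\,dy=\lambda\,\|u\|_{L^q(\Omega)}^{2-q}\int_\Omega|u|^{q-2}u\,\varphi\,dx\qquad\text{for all }\varphi\in\mathcal D^{s,2}_0(\Omega).$$ Assume that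 the embedding $\mathcal D^{s,2}_0(\Omega)\hookrightarrow L^q(\Omega)$ is compact, let $\lambda\in\mathfrak S(\Omega,s,q)$, and let $u$ be a corresponding $q$-semilinear $s$-eigenfunction. Then: (a) if $2^*_s<+\infty$, then $\|u\|_{L^\infty(\Omega)}\le \mathcal C_1\,\lambda^{\frac{2^*_s}{2(2^*_s-q)}}\,\|u\|_{L^q(\Omega)}$, with a constant $\mathcal C_1>0$ that depends only on $N,s,q$; (b) if $2^*_s=+\infty$, then $\|u\|_{L^\infty(\Omega)}\le \mathcal C_2\,\lambda\,\|u\|_{L^q(\Omega)}$, with a constant $\mathcal C_2>0$ that depends only on $N,s,q$ and $|\Omega|$ if $|\Omega|<+\infty$, and only on $N,s,q$ and $\Omega$ if $|\Omega|=+\infty$. -/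

import Mathlib

open MeasureTheory Filter Topology Set
open scoped ENNReal ContDiff

namespace FracSemilinear

noncomputable section

/-- Euclidean space `ℝ^N`. -/
abbrev Space (N : ℕ) : Type := EuclideanSpace ℝ (Fin N)

/-- The fractional Sobolev conjugate exponent `2^*_s`: it is `2N/(N-2s)` if `2s < N`, and `+∞`
otherwise. -/
def sobolevConj (N : ℕ) (s : ℝ) : ℝ≥0∞ :=
  if 2 * s < N then ENNReal.ofReal (2 * N / (N - 2 * s)) else ⊤

/-- The double integral `∫∫ (u(x)-u(y))² / |x-y|^{N+2s} dx dy`, with values in `[0,∞]`. -/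
def energy {N : ℕ} (s : ℝ) (u : Space N → ℝ) : ℝ≥0∞ :=
  ∫⁻ x, ∫⁻ y, ENNReal.ofReal ((u x - u y) ^ 2 / ‖x - y‖ ^ ((N : ℝ) + 2 * s))

/-- The double integral `∫∫ (u(x)-u(y))(φ(x)-φ(y)) / |x-y|^{N+2s} dx dy`. On functions of finite
energy the integrand is absolutely integrable on the product space. -/
def energyForm {N : ℕ} (s : ℝ) (u φ : Space N → ℝ) : ℝ :=
  ∫ x, ∫ y, (u x - u y) * (φ x - φ y) / ‖x - y‖ ^ ((N : ℝ) + 2 * s)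

/-- `φ ∈ C^∞_0(Ω)`: smooth, with compact support contained in `Ω`. -/
def IsTestFunction {N : ℕ} (Ω : Set (Space N)) (φ : Space N → ℝ) : Prop :=
  ContDiff ℝ ∞ φ ∧ HasCompactSupport φ ∧ tsupport φ ⊆ Ω

/-- The completion of `C^∞_0(Ω)` for the norm `energy^{1/2}`, realised as a space of functions: its
elements are the limits of sequences of test functions that are Cauchy for that norm. As soon as
the norm controls an `L^q` norm on test functions (in particular, whenever the embedding into
`L^q(Ω)` is compact), every class of Cauchy sequences has, along a subsequence, an almost everywhere
limit, this limit is unique almost everywhere, it determines the class, and its energy is the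
square of the norm of the class; so these are exactly the elements of the metric completion. -/
def D0 {N : ℕ} (Ω : Set (Space N)) (s : ℝ) : Set (Space N → ℝ) :=
  {u | ∃ φ : ℕ → Space N → ℝ, (∀ n, IsTestFunction Ω (φ n)) ∧
    Tendsto (fun p : ℕ × ℕ => energy s (φ p.1 - φ p.2)) atTop (𝓝 0) ∧
    ∀ᵐ x, Tendsto (fun n => φ n x) atTop (𝓝 (u x))}

/-- The `L^q(Ω)` norm, with values in `[0,∞]`. -/
def normLq {N : ℕ} (Ω : Set (Space N)) (q : ℝ) (u : Space N → ℝ) : ℝ≥0∞ :=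
  eLpNorm u (ENNReal.ofReal q) (volume.restrict Ω)

/-- The embedding of the energy space into `L^q(Ω)` is (well defined and) compact: every sequence
that is bounded in energy has a subsequence that converges in `L^q(Ω)`. -/
def CompactEmbedding {N : ℕ} (Ω : Set (Space N)) (s q : ℝ) : Prop :=
  (∀ u ∈ D0 Ω s, MemLp u (ENNReal.ofReal q) (volume.restrict Ω)) ∧
  ∀ u : ℕ → Space N → ℝ, (∀ n, u n ∈ D0 Ω s) →
    (∃ R : ℝ, ∀ n, energy s (u n) ≤ ENNReal.ofReal R) →
    ∃ v : Space N → ℝ, MemLp v (ENNReal.ofReal q) (volume.restrict Ω) ∧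
      ∃ k : ℕ → ℕ, StrictMono k ∧ Tendsto (fun n => normLq Ω q (u (k n) - v)) atTop (𝓝 0)

/-- `u` is a critical point of the energy along the constraint `∫_Ω |u|^q = 1`: the derivative of
the energy at `u` vanishes in every direction in which the derivative at `u` of the functional that
defines the constraint vanishes. -/
def IsConstrainedCriticalPoint {N : ℕ} (Ω : Set (Space N)) (s q : ℝ) (u : Space N → ℝ) : Prop :=
  u ∈ D0 Ω s ∧ (∫ x in Ω, |u x| ^ q) = 1 ∧
  ∀ φ ∈ D0 Ω s, HasDerivAt (fun t : ℝ => ∫ x in Ω, |u x + t * φ x| ^ q) 0 0 →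
    HasDerivAt (fun t : ℝ => (energy s (u + t • φ)).toReal) 0 0

/-- The `q`-semilinear `s`-spectrum of `Ω`: the constrained critical values. -/
def spectrumS {N : ℕ} (Ω : Set (Space N)) (s q : ℝ) : Set ℝ :=
  {lam | ∃ u, IsConstrainedCriticalPoint Ω s q u ∧ lam = (energy s u).toReal}

/-- `u` is a `q`-semilinear `s`-eigenfunction of `Ω` for `lam`: a non-trivial weak solution in the
energy space of `(-Δ)^s u = lam ‖u‖_q^{2-q} |u|^{q-2} u`. -/
def IsEigenfunction {N : ℕ} (Ω : Set (Space N)) (s q lam : ℝ) (u : Space N → ℝ) : Prop :=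
  u ∈ D0 Ω s ∧ ¬ (u =ᵐ[volume] 0) ∧
  ∀ φ ∈ D0 Ω s, energyForm s u φ =
    lam * (normLq Ω q u).toReal ^ (2 - q) * ∫ x in Ω, |u x| ^ (q - 2) * u x * φ x

end

end FracSemilinear

/-!
The argument is De Giorgi's. Testing the equation with a truncation `(u - k)₊`, whose energy is at
most its pairing with `u`, and applying a Sobolev inequality with an exponent `p > max 2 q` gives
`∫ (u - k)₊^p ≤ (A ∫ u₊^(q-1) (u - k)₊)^(p/2)` with `A = C² λ ‖u‖_q^(2-q)`. Along the levels
`K (1 - 2⁻ⁿ)` this makes `∫ u₊^(q-1) (u - k)₊` contract superlinearly, so that `u ≤ K` as soon as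
`K` is a suitable multiple of `λ^(p / (2 (p - q))) ‖u‖_q`; the same applies to `-u`.

The Sobolev inequalities come from one pointwise estimate. If `τ ≤ |v x - v y|` for all `y` outside
a set of measure at most `a`, then a ball around `x` of measure comparable to `a` contributes
`c τ² a^(-2s/N)` to `∫ (v x - v y)² / |x - y|^(N+2s) dy`. Taking for the exceptional set a level set
of `v` improves an `L^p` bound to an `L^e` bound with `e = 2 + 2 s p / N`. The fixed point of
`p ↦ e` is `2N / (N - 2s)` when `2s < N`; in the other case the iteration reaches every finite
exponent, and `p = 2q` turns the power of `λ` into the first.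
-/

namespace FracSemilinear

section EnergyNorm

variable {N : ℕ} {s : ℝ} {u v w φ : Space N → ℝ}

/-- The Gagliardo measure `|x - y|^{-N-2s} dx dy` on pairs of points, for which the double integral
`energy s u` is the squared `L²` norm of `(x, y) ↦ u x - u y`. The density is `0` on the diagonal,
in accordance with `a / 0 = 0` in `energy`. -/
noncomputable def gagliardoMeasure (N : ℕ) (s : ℝ) : Measure (Space N × Space N) :=
  (volume.prod volume).withDensity fun z => ENNReal.ofReal (‖z.1 - z.2‖ ^ ((N : ℝ) + 2 * s))⁻¹

/-- The difference `(x, y) ↦ u x - u y`, as a function on pairs of points. -/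
def pairDiff (u : Space N → ℝ) (z : Space N × Space N) : ℝ :=
  u z.1 - u z.2

/-- The Gagliardo seminorm, the square root of `energy s u` for measurable `u`. It is an `L²`
norm, which gives access to the theory of `Lᵖ` spaces. -/
noncomputable def energyNorm (s : ℝ) (u : Space N → ℝ) : ℝ≥0∞ :=
  eLpNorm (pairDiff u) 2 (gagliardoMeasure N s)

theorem lintegral_gagliardoMeasure {f : Space N × Space N → ℝ≥0∞}
    (hf : AEMeasurable f (volume.prod volume)) :
    ∫⁻ z, f z ∂gagliardoMeasure N s =
      ∫⁻ x, ∫⁻ y, ENNReal.ofReal (‖x - y‖ ^ ((N : ℝ) + 2 * s))⁻¹ * f (x, y) := by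
  have hdens : Measurable fun z : Space N × Space N =>
      ENNReal.ofReal (‖z.1 - z.2‖ ^ ((N : ℝ) + 2 * s))⁻¹ := by fun_prop
  rw [gagliardoMeasure, lintegral_withDensity_eq_lintegral_mul₀ hdens.aemeasurable hf]
  exact lintegral_prod _ (hdens.aemeasurable.mul hf)

theorem gagliardoMeasure_absolutelyContinuous :
    gagliardoMeasure N s ≪ (volume : Measure (Space N)).prod volume :=
  withDensity_absolutelyContinuous _ _

theorem ae_gagliardoMeasure_of_ae {p : Space N → Prop} (h : ∀ᵐ x, p x) :
    ∀ᵐ z ∂gagliardoMeasure N s, p z.1 ∧ p z.2 :=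
  gagliardoMeasure_absolutelyContinuous.ae_le
    ((Measure.quasiMeasurePreserving_fst.ae h).and (Measure.quasiMeasurePreserving_snd.ae h))

theorem aemeasurable_pairDiff (hu : AEMeasurable u) :
    AEMeasurable (pairDiff u) (volume.prod volume) :=
  (hu.comp_quasiMeasurePreserving Measure.quasiMeasurePreserving_fst).sub
    (hu.comp_quasiMeasurePreserving Measure.quasiMeasurePreserving_snd)

theorem aestronglyMeasurable_pairDiff (hu : AEMeasurable u) :
    AEStronglyMeasurable (pairDiff u) (gagliardoMeasure N s) :=
  ((aemeasurable_pairDiff hu).mono_ac gagliardoMeasure_absolutelyContinuous).aestronglyMeasurable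

theorem energyNorm_sq (hu : AEMeasurable u) : energyNorm s u ^ 2 = energy s u := by
  have hmeas := (aemeasurable_pairDiff hu).enorm.pow_const (2 : ℝ)
  rw [energyNorm, ← ENNReal.rpow_two]
  refine (eLpNorm_nnreal_pow_eq_lintegral (p := 2) two_ne_zero).trans ?_
  refine (lintegral_gagliardoMeasure hmeas).trans ?_
  refine lintegral_congr fun x => lintegral_congr fun y => ?_
  have hsq : ‖pairDiff u (x, y)‖ₑ ^ (2 : ℝ) = ENNReal.ofReal ((u x - u y) ^ 2) := by
    rw [Real.enorm_eq_ofReal_abs, ENNReal.ofReal_rpow_of_nonneg (abs_nonneg _) zero_le_two,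
      Real.rpow_two, sq_abs, pairDiff]
  rw [div_eq_inv_mul, ENNReal.ofReal_mul (by positivity)]
  exact congrArg _ hsq

theorem energyNorm_const_smul (c : ℝ) : energyNorm s (c • u) = ‖c‖ₑ * energyNorm s u := by
  have : pairDiff (c • u) = c • pairDiff u := by
    ext z
    simp [pairDiff, mul_sub]
  rw [energyNorm, this, eLpNorm_const_smul, energyNorm]

theorem pairDiff_sub : pairDiff (u - v) = pairDiff u - pairDiff v := by
  ext z
  simp only [pairDiff, Pi.sub_apply]
  ring

theorem energyNorm_sub_comm : energyNorm s (u - v) = energyNorm s (v - u) := by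
  rw [energyNorm, pairDiff_sub, eLpNorm_sub_comm, ← pairDiff_sub, energyNorm]

theorem energyNorm_sub_le_sub_add_sub (hu : AEMeasurable u) (hv : AEMeasurable v)
    (hw : AEMeasurable w) :
    energyNorm s (u - w) ≤ energyNorm s (u - v) + energyNorm s (v - w) := by
  have h : pairDiff (u - w) = pairDiff (u - v) + pairDiff (v - w) := by
    simp only [pairDiff_sub, sub_add_sub_cancel]
  rw [energyNorm, h]
  exact eLpNorm_add_le (aestronglyMeasurable_pairDiff (hu.sub hv))
    (aestronglyMeasurable_pairDiff (hv.sub hw)) one_le_two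

theorem energyNorm_le_add_energyNorm_sub (hu : AEMeasurable u) (hv : AEMeasurable v) :
    energyNorm s u ≤ energyNorm s v + energyNorm s (u - v) := by
  have h : pairDiff u = pairDiff v + pairDiff (u - v) := by
    rw [pairDiff_sub, add_sub_cancel]
  rw [energyNorm, h]
  exact eLpNorm_add_le (aestronglyMeasurable_pairDiff hv)
    (aestronglyMeasurable_pairDiff (hu.sub hv)) one_le_two

theorem energyNorm_le_liminf {φ : ℕ → Space N → ℝ} (hφ : ∀ n, AEMeasurable (φ n))
    (h : ∀ᵐ x, Tendsto (fun n => φ n x) atTop (𝓝 (u x))) :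
    energyNorm s u ≤ liminf (fun n => energyNorm s (φ n)) atTop := by
  refine Lp.eLpNorm_lim_le_liminf_eLpNorm (fun n => aestronglyMeasurable_pairDiff (hφ n)) _ ?_
  filter_upwards [ae_gagliardoMeasure_of_ae h] with z hz
  exact hz.1.sub hz.2

theorem energyForm_eq_integral (hu : AEMeasurable u) (hφ : AEMeasurable φ)
    (hus : energyNorm s u ≠ ⊤) (hφs : energyNorm s φ ≠ ⊤) :
    energyForm s u φ = ∫ z, pairDiff u z * pairDiff φ z ∂gagliardoMeasure N s := by
  have hint : Integrable (fun z => pairDiff u z * pairDiff φ z) (gagliardoMeasure N s) :=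
    MemLp.integrable_mul (p := 2) (q := 2) ⟨aestronglyMeasurable_pairDiff hu, hus.lt_top⟩
      ⟨aestronglyMeasurable_pairDiff hφ, hφs.lt_top⟩
  have hdens : Measurable fun z : Space N × Space N =>
      ENNReal.ofReal (‖z.1 - z.2‖ ^ ((N : ℝ) + 2 * s))⁻¹ := by fun_prop
  have hfin : ∀ᵐ z : Space N × Space N ∂(volume.prod volume),
      ENNReal.ofReal (‖z.1 - z.2‖ ^ ((N : ℝ) + 2 * s))⁻¹ < ⊤ :=
    Eventually.of_forall fun _ => ENNReal.ofReal_lt_top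
  rw [gagliardoMeasure, integrable_withDensity_iff_integrable_smul' hdens hfin] at hint
  rw [gagliardoMeasure, integral_withDensity_eq_integral_toReal_smul hdens hfin]
  refine Eq.trans ?_ (integral_prod _ hint).symm
  refine integral_congr_ae (Eventually.of_forall fun x => integral_congr_ae
    (Eventually.of_forall fun y => ?_))
  simp only [pairDiff, smul_eq_mul]
  rw [ENNReal.toReal_ofReal (by positivity), div_eq_inv_mul]

theorem abs_pairDiff_comp_le {G : ℝ → ℝ} (hG : LipschitzWith 1 G) (u : Space N → ℝ)
    (z : Space N × Space N) : |pairDiff (G ∘ u) z| ≤ |pairDiff u z| := by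
  simpa [Real.dist_eq, pairDiff] using hG.dist_le_mul (u z.1) (u z.2)

theorem energyNorm_comp_le {G : ℝ → ℝ} (hG : LipschitzWith 1 G) :
    energyNorm s (G ∘ u) ≤ energyNorm s u :=
  eLpNorm_mono (abs_pairDiff_comp_le hG u)

theorem sq_energyNorm_comp_le_energyForm {G : ℝ → ℝ} (hG : LipschitzWith 1 G) (hGmono : Monotone G)
    (hu : AEMeasurable u) (hus : energyNorm s u ≠ ⊤) :
    energyNorm s (G ∘ u) ^ 2 ≤ ENNReal.ofReal (energyForm s u (G ∘ u)) := by
  have hGu : AEMeasurable (G ∘ u) := hG.continuous.measurable.comp_aemeasurable hu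
  have hGus : energyNorm s (G ∘ u) ≠ ⊤ := ne_top_of_le_ne_top hus (energyNorm_comp_le hG)
  have hsq : ∀ z, pairDiff (G ∘ u) z ^ 2 ≤ pairDiff u z * pairDiff (G ∘ u) z := by
    intro z
    have hsign : 0 ≤ pairDiff u z * pairDiff (G ∘ u) z := by
      rcases le_total (u z.1) (u z.2) with h | h
      · exact mul_nonneg_of_nonpos_of_nonpos (sub_nonpos.2 h) (sub_nonpos.2 (hGmono h))
      · exact mul_nonneg (sub_nonneg.2 h) (sub_nonneg.2 (hGmono h))
    rw [← abs_of_nonneg hsign, abs_mul, ← sq_abs, sq]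
    exact mul_le_mul_of_nonneg_right (abs_pairDiff_comp_le hG u z) (abs_nonneg _)
  have hint : Integrable (fun z => pairDiff u z * pairDiff (G ∘ u) z) (gagliardoMeasure N s) :=
    MemLp.integrable_mul (p := 2) (q := 2) ⟨aestronglyMeasurable_pairDiff hu, hus.lt_top⟩
      ⟨aestronglyMeasurable_pairDiff hGu, hGus.lt_top⟩
  rw [energyForm_eq_integral hu hGu hus hGus, ofReal_integral_eq_lintegral_ofReal hint
    (Eventually.of_forall fun z => (sq_nonneg _).trans (hsq z)), energyNorm, ← ENNReal.rpow_two]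
  refine (eLpNorm_nnreal_pow_eq_lintegral (p := 2) two_ne_zero).trans_le
    (lintegral_mono fun z => ?_)
  rw [Real.enorm_eq_ofReal_abs, ENNReal.ofReal_rpow_of_nonneg (abs_nonneg _) NNReal.zero_le_coe]
  simpa using ENNReal.ofReal_le_ofReal (hsq z)

theorem tendsto_eLpNorm_of_dominated {α : Type*} [MeasurableSpace α] {μ : Measure α} {p : ℝ≥0∞}
    (hp0 : p ≠ 0) (hp : p ≠ ⊤) {F : ℕ → α → ℝ} {g : α → ℝ}
    (hF : ∀ n, AEStronglyMeasurable (F n) μ) (hg : MemLp g p μ) (hFg : ∀ n x, |F n x| ≤ |g x|)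
    (hlim : ∀ᵐ x ∂μ, Tendsto (fun n => F n x) atTop (𝓝 0)) :
    Tendsto (fun n => eLpNorm (F n) p μ) atTop (𝓝 0) := by
  have hp' : 0 < p.toReal := ENNReal.toReal_pos hp0 hp
  have hint : Tendsto (fun n => ∫⁻ x, ‖F n x‖ₑ ^ p.toReal ∂μ) atTop (𝓝 (∫⁻ _, 0 ∂μ)) := by
    refine tendsto_lintegral_of_dominated_convergence' (fun x => ‖g x‖ₑ ^ p.toReal)
      (fun n => (hF n).enorm.pow_const _)
      (fun n => Eventually.of_forall fun x => ENNReal.rpow_le_rpow ?_ hp'.le)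
      (lintegral_rpow_enorm_lt_top_of_eLpNorm_lt_top hp0 hp hg.2).ne ?_
    · simpa only [Real.enorm_eq_ofReal_abs] using ENNReal.ofReal_le_ofReal (hFg n x)
    · filter_upwards [hlim] with x hx
      simpa [hp'] using hx.enorm.ennrpow_const p.toReal
  simp only [eLpNorm_eq_lintegral_rpow_enorm_toReal hp0 hp]
  simpa [hp'] using hint.ennrpow_const (1 / p.toReal)

theorem abs_pairDiff_comp_sub_le {G : ℝ → ℝ} (hG : LipschitzWith 1 G) (u v : Space N → ℝ)
    (z : Space N × Space N) :
    |pairDiff (G ∘ v - G ∘ u) z| ≤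
      |pairDiff (v - u) z| + min |pairDiff (G ∘ v - G ∘ u) z| |2 * pairDiff u z| := by
  rcases le_total |pairDiff (G ∘ v - G ∘ u) z| |2 * pairDiff u z| with h | h
  · rw [min_eq_left h]
    exact le_add_of_nonneg_left (abs_nonneg _)
  · rw [min_eq_right h, abs_mul, abs_two, pairDiff_sub, pairDiff_sub, Pi.sub_apply, Pi.sub_apply]
    linarith [abs_sub (pairDiff (G ∘ v) z) (pairDiff (G ∘ u) z), abs_pairDiff_comp_le hG u z,
      abs_pairDiff_comp_le hG v z, abs_sub_abs_le_abs_sub (pairDiff v z) (pairDiff u z)]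

theorem tendsto_energyNorm_comp_sub {G : ℝ → ℝ} (hG : LipschitzWith 1 G) {φ : ℕ → Space N → ℝ}
    (hφ : ∀ n, AEMeasurable (φ n)) (hu : AEMeasurable u) (hus : energyNorm s u ≠ ⊤)
    (hφu : Tendsto (fun n => energyNorm s (φ n - u)) atTop (𝓝 0))
    (hae : ∀ᵐ x, Tendsto (fun n => φ n x) atTop (𝓝 (u x))) :
    Tendsto (fun n => energyNorm s (G ∘ φ n - G ∘ u)) atTop (𝓝 0) := by
  set F : ℕ → Space N × Space N → ℝ := fun n z =>
    min |pairDiff (G ∘ φ n - G ∘ u) z| |2 * pairDiff u z| with hF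
  have hGm : Measurable G := hG.continuous.measurable
  have hum := aestronglyMeasurable_pairDiff (s := s) hu
  have hφm := fun n => aestronglyMeasurable_pairDiff (s := s) ((hφ n).sub hu)
  have hFm : ∀ n, AEStronglyMeasurable (F n) (gagliardoMeasure N s) := fun n =>
    (aestronglyMeasurable_pairDiff
      ((hGm.comp_aemeasurable (hφ n)).sub (hGm.comp_aemeasurable hu))).norm.inf
      (hum.const_mul 2).norm
  have hF0 : Tendsto (fun n => eLpNorm (F n) 2 (gagliardoMeasure N s)) atTop (𝓝 0) := by
    refine tendsto_eLpNorm_of_dominated two_ne_zero ENNReal.ofNat_ne_top hFm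
      (MemLp.const_mul ⟨hum, hus.lt_top⟩ 2) (fun n z => ?_) ?_
    · rw [abs_of_nonneg (le_min (abs_nonneg _) (abs_nonneg _))]
      exact min_le_right _ _
    · filter_upwards [ae_gagliardoMeasure_of_ae hae] with z hz
      have hz0 : Tendsto (fun n => pairDiff (G ∘ φ n - G ∘ u) z) atTop (𝓝 0) := by
        simpa [pairDiff] using (((hG.continuous.tendsto _).comp hz.1).sub_const (G (u z.1))).sub
          (((hG.continuous.tendsto _).comp hz.2).sub_const (G (u z.2)))
      simpa [hF] using hz0.abs.min (tendsto_const_nhds (x := |2 * pairDiff u z|))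
  refine tendsto_of_tendsto_of_tendsto_of_le_of_le tendsto_const_nhds
    (by simpa using hφu.add hF0) (fun _ => zero_le) fun n => ?_
  refine (eLpNorm_mono_real (abs_pairDiff_comp_sub_le hG u (φ n))).trans ?_
  refine (eLpNorm_add_le (hφm n).norm (hFm n) one_le_two).trans_eq ?_
  rw [eLpNorm_norm, energyNorm]

end EnergyNorm

section TestFunctions

variable {N : ℕ} {s : ℝ} {u : Space N → ℝ} {Ω Ω' : Set (Space N)}

theorem integrable_min_sq_one_div_norm_rpow (hs0 : 0 < s) (hs1 : s < 1) :
    Integrable fun z : Space N => min (‖z‖ ^ 2) 1 / ‖z‖ ^ ((N : ℝ) + 2 * s) := by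
  rcases N.eq_zero_or_pos with rfl | hN
  · exact (integrable_zero _ _ _).congr
      (Eventually.of_forall fun z => by simp [Subsingleton.elim z 0])
  have : Nonempty (Fin N) := ⟨⟨0, hN⟩⟩
  refine (integrable_fun_norm_addHaar volume
    (f := fun r : ℝ => min (r ^ 2) 1 / r ^ ((N : ℝ) + 2 * s))).2 ?_
  have hpow : ∀ r : ℝ, r ^ (N - 1) = r ^ ((N : ℝ) - 1) := fun r => by
    rw [← Real.rpow_natCast, Nat.cast_sub hN, Nat.cast_one]
  rw [finrank_euclideanSpace_fin, ← Ioc_union_Ioi_eq_Ioi (zero_le_one' ℝ)]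
  refine IntegrableOn.union ?_ ?_
  · have hnear : IntegrableOn (fun r : ℝ => r ^ (1 - 2 * s)) (Ioc 0 1) :=
      (intervalIntegral.intervalIntegrable_rpow' (by linarith)).1
    refine hnear.congr_fun (fun r ⟨hr0, hr1⟩ => ?_) measurableSet_Ioc
    simp only [smul_eq_mul]
    rw [min_eq_left (pow_le_one₀ hr0.le hr1), ← Real.rpow_two, hpow, ← Real.rpow_sub hr0,
      ← Real.rpow_add hr0]
    congr 1
    ring
  · have hfar : IntegrableOn (fun r : ℝ => r ^ (-1 - 2 * s)) (Ioi 1) :=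
      integrableOn_Ioi_rpow_of_lt (by linarith) one_pos
    refine hfar.congr_fun (fun r (hr1 : 1 < r) => ?_) measurableSet_Ioi
    have hr0 : 0 < r := one_pos.trans hr1
    simp only [smul_eq_mul]
    rw [min_eq_right (one_le_pow₀ hr1.le), hpow, one_div, ← Real.rpow_neg hr0.le,
      ← Real.rpow_add hr0]
    congr 1
    ring

theorem energy_le_of_density_le {K : Set (Space N)} (hK : MeasurableSet K)
    (huK : ∀ x ∉ K, u x = 0) {g : Space N → ℝ≥0∞} (hg : Measurable g)
    (hle : ∀ x y, ENNReal.ofReal ((u x - u y) ^ 2 / ‖x - y‖ ^ ((N : ℝ) + 2 * s)) ≤ g (x - y)) :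
    energy s u ≤ 2 * (volume K * ∫⁻ z, g z) := by
  set χ : Space N → ℝ≥0∞ := K.indicator 1
  have hχ : Measurable χ := measurable_one.indicator hK
  have hχg₁ : Measurable fun z : Space N × Space N => χ z.1 * g (z.1 - z.2) := by fun_prop
  have hχg₂ : Measurable fun z : Space N × Space N => χ z.2 * g (z.1 - z.2) := by fun_prop
  have hpt : ∀ x y, ENNReal.ofReal ((u x - u y) ^ 2 / ‖x - y‖ ^ ((N : ℝ) + 2 * s)) ≤
      χ x * g (x - y) + χ y * g (x - y) := by
    intro x y
    by_cases hx : x ∈ K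
    · simpa [χ, hx] using (hle x y).trans le_self_add
    by_cases hy : y ∈ K
    · simpa [χ, hx, hy] using hle x y
    · simp [huK x hx, huK y hy]
  have h₁ : ∫⁻ x, ∫⁻ y, χ x * g (x - y) = volume K * ∫⁻ z, g z := by
    rw [← lintegral_indicator_one hK, ← lintegral_mul_const _ hχ]
    refine lintegral_congr fun x => ?_
    rw [lintegral_const_mul _ (by fun_prop), lintegral_sub_left_eq_self]
  have h₂ : ∫⁻ x, ∫⁻ y, χ y * g (x - y) = volume K * ∫⁻ z, g z := by
    rw [lintegral_lintegral_swap hχg₂.aemeasurable, ← lintegral_indicator_one hK,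
      ← lintegral_mul_const _ hχ]
    refine lintegral_congr fun y => ?_
    rw [lintegral_const_mul _ (by fun_prop), lintegral_sub_right_eq_self]
  calc energy s u ≤ ∫⁻ x, ∫⁻ y, (χ x * g (x - y) + χ y * g (x - y)) :=
        lintegral_mono fun x => lintegral_mono fun y => hpt x y
    _ = ∫⁻ x, ((∫⁻ y, χ x * g (x - y)) + ∫⁻ y, χ y * g (x - y)) :=
        lintegral_congr fun x => lintegral_add_left (by fun_prop) _
    _ = 2 * (volume K * ∫⁻ z, g z) := by
        rw [lintegral_add_left hχg₁.lintegral_prod_right', h₁, h₂, two_mul]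

theorem energy_lt_top_of_lipschitzWith (hs0 : 0 < s) (hs1 : s < 1) {K : Set (Space N)}
    (hK : MeasurableSet K) (hKfin : volume K ≠ ⊤) (huK : ∀ x ∉ K, u x = 0) {L : NNReal} {M : ℝ}
    (huL : LipschitzWith L u) (huM : ∀ x, |u x| ≤ M) : energy s u < ⊤ := by
  set c : ℝ := L ^ 2 + (2 * M) ^ 2
  have hker := (integrable_min_sq_one_div_norm_rpow (N := N) hs0 hs1).const_mul c
  refine (energy_le_of_density_le hK huK (g := fun z => ENNReal.ofReal
    (c * (min (‖z‖ ^ 2) 1 / ‖z‖ ^ ((N : ℝ) + 2 * s)))) (by fun_prop) fun x y => ?_).trans_lt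
    (ENNReal.mul_lt_top (by simp) (ENNReal.mul_lt_top hKfin.lt_top hker.lintegral_lt_top))
  have hnear : (u x - u y) ^ 2 ≤ L ^ 2 * ‖x - y‖ ^ 2 := by
    have := huL.dist_le_mul x y
    rw [Real.dist_eq, dist_eq_norm] at this
    rw [← sq_abs, ← mul_pow]
    exact pow_le_pow_left₀ (abs_nonneg _) this 2
  have hfar : (u x - u y) ^ 2 ≤ (2 * M) ^ 2 := by
    rw [← sq_abs]
    exact pow_le_pow_left₀ (abs_nonneg _)
      (by linarith [abs_sub (u x) (u y), huM x, huM y]) 2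
  rw [← mul_div_assoc]
  refine ENNReal.ofReal_le_ofReal (div_le_div_of_nonneg_right ?_ (by positivity))
  rcases le_total (‖x - y‖ ^ 2) 1 with h | h
  · rw [min_eq_left h, add_mul]
    exact le_add_of_le_of_nonneg hnear (by positivity)
  · rw [min_eq_right h, mul_one]
    exact le_add_of_nonneg_of_le (by positivity) hfar

theorem IsTestFunction.mono (hΩ : Ω ⊆ Ω') (hu : IsTestFunction Ω u) : IsTestFunction Ω' u :=
  ⟨hu.1, hu.2.1, hu.2.2.trans hΩ⟩

theorem IsTestFunction.aemeasurable (hu : IsTestFunction Ω u) : AEMeasurable u :=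
  hu.1.continuous.aemeasurable

theorem IsTestFunction.const_smul (hu : IsTestFunction Ω u) (c : ℝ) : IsTestFunction Ω (c • u) :=
  ⟨contDiff_const.smul hu.1, hu.2.1.smul_left (f := fun _ => c),
    (closure_mono (Function.support_const_smul_subset c u)).trans hu.2.2⟩

theorem IsTestFunction.comp {G : ℝ → ℝ} (hG : ContDiff ℝ ∞ G) (hG0 : G 0 = 0)
    (hu : IsTestFunction Ω u) : IsTestFunction Ω (G ∘ u) :=
  ⟨hG.comp hu.1, hu.2.1.comp_left hG0,
    (closure_mono (Function.support_comp_subset hG0 u)).trans hu.2.2⟩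

theorem IsTestFunction.energyNorm_ne_top (hs0 : 0 < s) (hs1 : s < 1) (hu : IsTestFunction Ω u) :
    energyNorm s u ≠ ⊤ := by
  obtain ⟨L, hL⟩ := hu.1.lipschitzWith_of_hasCompactSupport hu.2.1 (by simp)
  obtain ⟨M, hM⟩ := hu.2.1.exists_bound_of_continuous hu.1.continuous
  have hfin := energy_lt_top_of_lipschitzWith hs0 hs1 hu.2.1.isCompact.measurableSet
    hu.2.1.isCompact.measure_ne_top (fun x => image_eq_zero_of_notMem_tsupport) hL hM
  rw [← energyNorm_sq hu.aemeasurable] at hfin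
  exact (ENNReal.pow_lt_top_iff.1 hfin).resolve_right two_ne_zero |>.ne

end TestFunctions

section EnergySpace

variable {N : ℕ} {s : ℝ} {u : Space N → ℝ} {Ω Ω' : Set (Space N)}

theorem tendsto_energy_zero_iff {ι : Type*} {l : Filter ι} {v : ι → Space N → ℝ}
    (hv : ∀ i, AEMeasurable (v i)) :
    Tendsto (fun i => energy s (v i)) l (𝓝 0) ↔ Tendsto (fun i => energyNorm s (v i)) l (𝓝 0) := by
  simp only [← energyNorm_sq (hv _), ← ENNReal.rpow_two]
  refine ⟨fun h => ?_, fun h => by simpa using h.ennrpow_const 2⟩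
  have hsqrt := h.ennrpow_const (1 / 2)
  simpa only [← ENNReal.rpow_mul, mul_one_div_cancel (two_ne_zero' ℝ), ENNReal.rpow_one,
    ENNReal.zero_rpow_of_pos one_half_pos] using hsqrt

theorem aemeasurable_of_tendsto_isTestFunction {φ : ℕ → Space N → ℝ}
    (hφ : ∀ n, IsTestFunction Ω (φ n)) (hae : ∀ᵐ x, Tendsto (fun n => φ n x) atTop (𝓝 (u x))) :
    AEMeasurable u :=
  aemeasurable_of_tendsto_metrizable_ae _ (fun n => (hφ n).aemeasurable) hae

theorem D0.aemeasurable (hu : u ∈ D0 Ω s) : AEMeasurable u :=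
  let ⟨_, hφ, _, hae⟩ := hu
  aemeasurable_of_tendsto_isTestFunction hφ hae

theorem mem_D0_iff : u ∈ D0 Ω s ↔ ∃ φ : ℕ → Space N → ℝ, (∀ n, IsTestFunction Ω (φ n)) ∧
    Tendsto (fun n => energyNorm s (φ n - u)) atTop (𝓝 0) ∧
    ∀ᵐ x, Tendsto (fun n => φ n x) atTop (𝓝 (u x)) := by
  refine exists_congr fun φ => and_congr_right fun hφ => and_congr_left fun hae => ?_
  have hφm := fun n => (hφ n).aemeasurable
  have hum := aemeasurable_of_tendsto_isTestFunction hφ hae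
  rw [tendsto_energy_zero_iff fun p : ℕ × ℕ => (hφm p.1).sub (hφm p.2)]
  refine ⟨fun hcauchy => ENNReal.tendsto_nhds_zero.2 fun ε hε => ?_, fun hlim => ?_⟩
  · obtain ⟨⟨a, b⟩, hab⟩ := eventually_atTop.1 (ENNReal.tendsto_nhds_zero.1 hcauchy ε hε)
    filter_upwards [eventually_ge_atTop a] with n hn
    refine (energyNorm_le_liminf (φ := fun m => φ n - φ m) (fun m => (hφm n).sub (hφm m)) ?_).trans
      (liminf_le_of_frequently_le' (Eventually.frequently ?_))
    · filter_upwards [hae] with x hx using tendsto_const_nhds.sub hx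
    · filter_upwards [eventually_ge_atTop b] with m hm using hab (n, m) ⟨hn, hm⟩
  · have hsum : Tendsto (fun p : ℕ × ℕ => energyNorm s (φ p.1 - u) + energyNorm s (φ p.2 - u))
        atTop (𝓝 0) := by
      rw [← prod_atTop_atTop_eq]
      simpa using (hlim.comp tendsto_fst).add (hlim.comp tendsto_snd)
    refine tendsto_of_tendsto_of_tendsto_of_le_of_le tendsto_const_nhds hsum (fun _ => zero_le)
      fun p => ?_
    rw [energyNorm_sub_comm (u := φ p.2)]
    exact energyNorm_sub_le_sub_add_sub (hφm p.1) hum (hφm p.2)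

theorem D0_mono (hΩ : Ω ⊆ Ω') : D0 Ω s ⊆ D0 Ω' s :=
  fun _ ⟨φ, hφ, hφu⟩ => ⟨φ, fun n => (hφ n).mono hΩ, hφu⟩

theorem D0.ae_eq_zero (hu : u ∈ D0 Ω s) : ∀ᵐ x, x ∉ Ω → u x = 0 := by
  obtain ⟨φ, hφ, -, hae⟩ := hu
  filter_upwards [hae] with x hx hxΩ
  have hφx : ∀ n, φ n x = 0 := fun n =>
    image_eq_zero_of_notMem_tsupport fun hmem => hxΩ ((hφ n).2.2 hmem)
  simp only [hφx] at hx
  exact tendsto_nhds_unique hx tendsto_const_nhds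

theorem D0.const_smul (hu : u ∈ D0 Ω s) (c : ℝ) : c • u ∈ D0 Ω s := by
  obtain ⟨φ, hφ, hlim, hae⟩ := mem_D0_iff.1 hu
  refine mem_D0_iff.2 ⟨fun n => c • φ n, fun n => (hφ n).const_smul c, ?_, ?_⟩
  · simp only [← smul_sub, energyNorm_const_smul]
    simpa using ENNReal.Tendsto.const_mul hlim (Or.inr (enorm_ne_top (x := c)))
  · filter_upwards [hae] with x hx using hx.const_smul c

theorem D0.neg (hu : u ∈ D0 Ω s) : -u ∈ D0 Ω s := by
  simpa using D0.const_smul hu (-1)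

theorem D0.energyNorm_ne_top (hs0 : 0 < s) (hs1 : s < 1) (hu : u ∈ D0 Ω s) :
    energyNorm s u ≠ ⊤ := by
  obtain ⟨φ, hφ, hlim, -⟩ := mem_D0_iff.1 hu
  obtain ⟨n, hn⟩ := (ENNReal.tendsto_nhds_zero.1 hlim 1 one_pos).exists
  refine ne_top_of_le_ne_top ?_
    (energyNorm_le_add_energyNorm_sub (D0.aemeasurable hu) (hφ n).aemeasurable)
  rw [energyNorm_sub_comm]
  exact ENNReal.add_ne_top.2 ⟨(hφ n).energyNorm_ne_top hs0 hs1,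
    ne_top_of_le_ne_top ENNReal.one_ne_top hn⟩

theorem D0.comp (hs0 : 0 < s) (hs1 : s < 1) {G : ℝ → ℝ} (hG : ContDiff ℝ ∞ G) (hG0 : G 0 = 0)
    (hGL : LipschitzWith 1 G) (hu : u ∈ D0 Ω s) : G ∘ u ∈ D0 Ω s := by
  obtain ⟨φ, hφ, hlim, hae⟩ := mem_D0_iff.1 hu
  refine mem_D0_iff.2 ⟨fun n => G ∘ φ n, fun n => (hφ n).comp hG hG0,
    tendsto_energyNorm_comp_sub hGL (fun n => (hφ n).aemeasurable) (D0.aemeasurable hu)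
      (D0.energyNorm_ne_top hs0 hs1 hu) hlim hae, ?_⟩
  filter_upwards [hae] with x hx using (hG.continuous.tendsto _).comp hx

theorem normLq_eq_eLpNorm {q : ℝ} (hu : u ∈ D0 Ω s) :
    normLq Ω q u = eLpNorm u (ENNReal.ofReal q) volume := by
  have hind : (toMeasurable volume Ω).indicator u =ᵐ[volume] u := by
    filter_upwards [D0.ae_eq_zero hu] with x hx
    exact indicator_apply_eq_self.2 fun h => hx fun hxΩ => h (subset_toMeasurable _ _ hxΩ)
  rw [normLq, ← Measure.restrict_toMeasurable_of_sFinite,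
    ← eLpNorm_indicator_eq_eLpNorm_restrict (measurableSet_toMeasurable _ _),
    eLpNorm_congr_ae hind]

end EnergySpace

section FibreEstimates

variable {N : ℕ} {s τ p : ℝ} {v : Space N → ℝ} {x : Space N} {T : Set (Space N)} {a : ℝ≥0∞}

/-- The inner integral of `energy`, with the first point `x` frozen. -/
noncomputable def fibreEnergy (s : ℝ) (v : Space N → ℝ) (x : Space N) : ℝ≥0∞ :=
  ∫⁻ y, ENNReal.ofReal ((v x - v y) ^ 2 / ‖x - y‖ ^ ((N : ℝ) + 2 * s))

theorem sq_mul_le_mul_fibreEnergy (hs : 0 ≤ s) (hτ : 0 < τ) {r : ℝ}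
    (ha : a + volume T ≤ volume (Metric.ball x r)) (hT : volume T ≠ ⊤)
    (hτv : ∀ y ∉ T, τ ≤ |v x - v y|) :
    ENNReal.ofReal τ ^ 2 * a ≤ ENNReal.ofReal (r ^ ((N : ℝ) + 2 * s)) * fibreEnergy s v x := by
  set A := Metric.ball x r \ toMeasurable volume T
  have hAa : a ≤ volume A := by
    refine le_trans ?_ le_measure_sdiff
    rw [measure_toMeasurable]
    exact ENNReal.le_sub_of_add_le_right hT ha
  have hpt : ∀ y ∈ A, ENNReal.ofReal τ ^ 2 ≤ ENNReal.ofReal (r ^ ((N : ℝ) + 2 * s)) *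
      ENNReal.ofReal ((v x - v y) ^ 2 / ‖x - y‖ ^ ((N : ℝ) + 2 * s)) := by
    rintro y ⟨hyr, hyT⟩
    have hτy := hτv y fun h => hyT (subset_toMeasurable _ _ h)
    have hxy : 0 < ‖x - y‖ := norm_sub_pos_iff.2 fun h => by
      rw [h, sub_self, abs_zero] at hτy
      exact hτ.not_ge hτy
    have hyr' : ‖x - y‖ ≤ r := by
      rw [← dist_eq_norm, dist_comm]
      exact (Metric.mem_ball.1 hyr).le
    have hr : 0 ≤ r := hxy.le.trans hyr'
    rw [← ENNReal.ofReal_pow hτ.le, ← ENNReal.ofReal_mul (by positivity), ← mul_div_assoc,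
      mul_div_right_comm]
    refine ENNReal.ofReal_le_ofReal ((pow_le_pow_left₀ hτ.le hτy 2).trans ?_)
    rw [sq_abs]
    refine le_mul_of_one_le_left (sq_nonneg _) ((one_le_div (by positivity)).2 ?_)
    exact Real.rpow_le_rpow hxy.le hyr' (by positivity)
  calc ENNReal.ofReal τ ^ 2 * a ≤ ∫⁻ _ in A, ENNReal.ofReal τ ^ 2 := by
        rw [setLIntegral_const]
        gcongr
    _ ≤ ∫⁻ y in A, ENNReal.ofReal (r ^ ((N : ℝ) + 2 * s)) *
          ENNReal.ofReal ((v x - v y) ^ 2 / ‖x - y‖ ^ ((N : ℝ) + 2 * s)) :=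
        setLIntegral_mono' (measurableSet_ball.diff (measurableSet_toMeasurable _ _)) hpt
    _ ≤ ENNReal.ofReal (r ^ ((N : ℝ) + 2 * s)) * fibreEnergy s v x := by
        rw [lintegral_const_mul' _ _ ENNReal.ofReal_ne_top]
        gcongr
        exact setLIntegral_le_lintegral _ _

theorem exists_sq_le_mul_fibreEnergy (hN : 1 ≤ N) (hs : 0 ≤ s) :
    ∃ C : NNReal, ∀ (v : Space N → ℝ) (x : Space N) (T : Set (Space N)) (τ : ℝ) (a : ℝ≥0∞),
      a ≠ 0 → a ≠ ⊤ → volume T ≤ a → (∀ y ∉ T, τ ≤ |v x - v y|) →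
      ENNReal.ofReal τ ^ 2 ≤ C * a ^ (2 * s / N) * fibreEnergy s v x := by
  have : Nonempty (Fin N) := ⟨⟨0, hN⟩⟩
  have hN0 : (0 : ℝ) < N := by exact_mod_cast hN
  set β := volume (Metric.ball (0 : Space N) 1)
  have hβ0 : β ≠ 0 := (Metric.measure_ball_pos _ _ one_pos).ne'
  have hβtop : β ≠ ⊤ := measure_ball_lt_top.ne
  have hC : (2 / β) ^ (1 + 2 * s / N) ≠ ⊤ :=
    ENNReal.rpow_ne_top_of_nonneg (by positivity) (ENNReal.div_ne_top ENNReal.ofNat_ne_top hβ0)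
  refine ⟨((2 / β) ^ (1 + 2 * s / N)).toNNReal, fun v x T τ a ha0 hatop hTa hτv => ?_⟩
  rw [ENNReal.coe_toNNReal hC]
  rcases le_or_gt τ 0 with hτ | hτ
  · simp [ENNReal.ofReal_of_nonpos hτ]
  have hbtop : 2 / β * a ≠ ⊤ :=
    ENNReal.mul_ne_top (ENNReal.div_ne_top ENNReal.ofNat_ne_top hβ0) hatop
  set r : ℝ := (2 / β * a).toReal ^ (1 / (N : ℝ)) with hr
  have hr0 : 0 ≤ r := by positivity
  have hrpow : ∀ e : ℝ, 0 ≤ e → ENNReal.ofReal (r ^ (N * e)) = (2 / β * a) ^ e := fun e he => by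
    rw [hr, ← Real.rpow_mul ENNReal.toReal_nonneg, ← mul_assoc, one_div_mul_cancel hN0.ne', one_mul,
      ← ENNReal.ofReal_rpow_of_nonneg ENNReal.toReal_nonneg he, ENNReal.ofReal_toReal hbtop]
  have hball : volume (Metric.ball x r) = 2 * a := by
    have := hrpow 1 zero_le_one
    rw [mul_one, Real.rpow_natCast, ENNReal.rpow_one] at this
    rw [Measure.addHaar_ball _ _ hr0, finrank_euclideanSpace_fin, this, mul_right_comm,
      ENNReal.div_mul_cancel hβ0 hβtop]
  have hvol : a + volume T ≤ volume (Metric.ball x r) := by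
    rw [hball, two_mul]
    gcongr
  have hexp : (N : ℝ) + 2 * s = N * (1 + 2 * s / N) := by field_simp
  have key := sq_mul_le_mul_fibreEnergy hs hτ hvol (ne_top_of_le_ne_top hatop hTa) hτv
  rw [hexp, hrpow _ (by positivity), ENNReal.mul_rpow_of_nonneg _ _ (by positivity),
    ENNReal.rpow_add (x := a) _ _ ha0 hatop, ENNReal.rpow_one, mul_comm a, ← mul_assoc,
    mul_right_comm _ a] at key
  exact (ENNReal.mul_le_mul_iff_left ha0 hatop).1 key

theorem enorm_div_two_rpow_le {C : NNReal} {θ : ℝ} (hθ : 0 ≤ θ) (hp : 0 < p)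
    (hC : ∀ (T : Set (Space N)) (τ : ℝ) (a : ℝ≥0∞), a ≠ 0 → a ≠ ⊤ → volume T ≤ a →
      (∀ y ∉ T, τ ≤ |v x - v y|) → ENNReal.ofReal τ ^ 2 ≤ C * a ^ θ * fibreEnergy s v x)
    (hv : AEMeasurable v) (hfin : ∫⁻ y, ‖v y‖ₑ ^ p ≠ ⊤) (hpos : ∫⁻ y, ‖v y‖ₑ ^ p ≠ 0) :
    (‖v x‖ₑ / 2) ^ (2 + p * θ) ≤ C * (∫⁻ y, ‖v y‖ₑ ^ p) ^ θ * fibreEnergy s v x := by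
  set A := ∫⁻ y, ‖v y‖ₑ ^ p
  set t := ‖v x‖ₑ / 2
  have httop : t ≠ ⊤ := ENNReal.div_ne_top enorm_ne_top two_ne_zero
  rcases eq_or_ne t 0 with ht0 | ht0
  · rw [ht0, ENNReal.zero_rpow_of_pos (by positivity)]
    exact zero_le
  have htp0 : t ^ p ≠ 0 := (ENNReal.rpow_pos (pos_iff_ne_zero.2 ht0) httop).ne'
  have htptop : t ^ p ≠ ⊤ := ENNReal.rpow_ne_top_of_nonneg hp.le httop
  have hT : volume {y | t ^ p ≤ ‖v y‖ₑ ^ p} ≤ A / t ^ p :=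
    meas_ge_le_lintegral_div (hv.enorm.pow_const p) htp0 htptop
  have hτ : ∀ y ∉ {y | t ^ p ≤ ‖v y‖ₑ ^ p}, |v x| / 2 ≤ |v x - v y| := by
    intro y hy
    have hlt : ENNReal.ofReal |v y| < ENNReal.ofReal (|v x| / 2) := by
      rw [ENNReal.ofReal_div_of_pos two_pos, ENNReal.ofReal_ofNat, ← Real.enorm_eq_ofReal_abs,
        ← Real.enorm_eq_ofReal_abs]
      exact (ENNReal.rpow_lt_rpow_iff hp).1 (not_le.1 hy)
    have := (ENNReal.ofReal_lt_ofReal_iff_of_nonneg (abs_nonneg _)).1 hlt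
    linarith [abs_sub_abs_le_abs_sub (v x) (v y)]
  have hsq : t ^ (2 : ℝ) ≤ C * (A / t ^ p) ^ θ * fibreEnergy s v x := by
    have := hC _ _ _ (ENNReal.div_ne_zero.2 ⟨hpos, htptop⟩) (ENNReal.div_ne_top hfin htp0) hT hτ
    rwa [ENNReal.ofReal_div_of_pos two_pos, ENNReal.ofReal_ofNat, ← Real.enorm_eq_ofReal_abs,
      ← ENNReal.rpow_two] at this
  calc t ^ (2 + p * θ) = t ^ (2 : ℝ) * (t ^ p) ^ θ := by
        rw [ENNReal.rpow_add _ _ ht0 httop, ENNReal.rpow_mul]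
    _ ≤ C * (A / t ^ p) ^ θ * fibreEnergy s v x * (t ^ p) ^ θ := by gcongr
    _ = C * A ^ θ * fibreEnergy s v x := by
        rw [mul_right_comm, mul_assoc (C : ℝ≥0∞), ← ENNReal.mul_rpow_of_nonneg _ _ hθ,
          ENNReal.div_mul_cancel htp0 htptop]

end FibreEstimates

section SobolevInequality

variable {N : ℕ} {s p : ℝ} {v : Space N → ℝ} {W : Set (Space N → ℝ)} {Ω : Set (Space N)}

/-- The Sobolev inequality `‖v‖_p ≤ C [v]_s` on the class of functions `W`, with one constant `C`
for the whole class. -/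
def SobolevInequality (W : Set (Space N → ℝ)) (s p : ℝ) : Prop :=
  ∃ C : NNReal, ∀ v ∈ W, eLpNorm v (ENNReal.ofReal p) volume ≤ C * energyNorm s v

theorem eLpNorm_ofReal_rpow {α : Type*} [MeasurableSpace α] {μ : Measure α} {f : α → ℝ}
    (hp : 0 < p) : eLpNorm f (ENNReal.ofReal p) μ ^ p = ∫⁻ x, ‖f x‖ₑ ^ p ∂μ := by
  have h := eLpNorm_nnreal_pow_eq_lintegral (f := f) (μ := μ) (Real.toNNReal_pos.2 hp).ne'
  rwa [Real.coe_toNNReal p hp.le] at h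

theorem SobolevInequality.of_rpow_le {r : ℝ} (hr : 0 < r) {C : ℝ≥0∞} (hC : C ≠ ⊤)
    (h : ∀ v ∈ W, eLpNorm v (ENNReal.ofReal p) volume ^ r ≤ C * energyNorm s v ^ r) :
    SobolevInequality W s p := by
  refine ⟨(C ^ r⁻¹).toNNReal, fun v hv => (ENNReal.rpow_le_rpow_iff hr).1 ?_⟩
  rw [ENNReal.coe_toNNReal (ENNReal.rpow_ne_top_of_nonneg (by positivity) hC),
    ENNReal.mul_rpow_of_nonneg _ _ hr.le, ENNReal.rpow_inv_rpow hr.ne']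
  exact h v hv

theorem SobolevInequality.mono {W' : Set (Space N → ℝ)} (h : SobolevInequality W s p)
    (hW : W' ⊆ W) : SobolevInequality W' s p :=
  h.imp fun _ hC v hv => hC v (hW hv)

theorem SobolevInequality.memLp (h : SobolevInequality W s p) (hv : v ∈ W) (hvm : AEMeasurable v)
    (hfin : energyNorm s v ≠ ⊤) : MemLp v (ENNReal.ofReal p) volume :=
  ⟨hvm.aestronglyMeasurable, h.elim fun _ hC =>
    (hC v hv).trans_lt (ENNReal.mul_lt_top ENNReal.coe_lt_top hfin.lt_top)⟩

theorem sobolevInequality_two_of_volume_support_le (hN : 1 ≤ N) (hs : 0 ≤ s) {m : ℝ≥0∞}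
    (hm : m ≠ ⊤) :
    SobolevInequality {v : Space N → ℝ | AEMeasurable v ∧ volume (Function.support v) ≤ m} s 2 := by
  obtain ⟨C, hC⟩ := exists_sq_le_mul_fibreEnergy hN hs
  have hm1 : m + 1 ≠ ⊤ := ENNReal.add_ne_top.2 ⟨hm, ENNReal.one_ne_top⟩
  have hK : C * (m + 1) ^ (2 * s / N) ≠ ⊤ :=
    ENNReal.mul_ne_top ENNReal.coe_ne_top (ENNReal.rpow_ne_top_of_nonneg (by positivity) hm1)
  refine .of_rpow_le two_pos hK fun v ⟨hv, hvm⟩ => ?_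
  rw [eLpNorm_ofReal_rpow two_pos, ENNReal.rpow_two, energyNorm_sq hv]
  change _ ≤ _ * ∫⁻ x, fibreEnergy s v x
  rw [← lintegral_const_mul' _ _ hK]
  refine lintegral_mono fun x => ?_
  rw [Real.enorm_eq_ofReal_abs, ENNReal.rpow_two]
  refine hC v x (Function.support v) |v x| (m + 1) (by simp) hm1 (hvm.trans le_self_add)
    fun y hy => ?_
  rw [Function.notMem_support.1 hy, sub_zero]

theorem exists_eLpNorm_rpow_le (hN : 1 ≤ N) (hs : 0 ≤ s) (hp : 0 < p) :
    ∃ C : NNReal, ∀ v : Space N → ℝ, AEMeasurable v →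
      eLpNorm v (ENNReal.ofReal p) volume ≠ ⊤ →
      eLpNorm v (ENNReal.ofReal (2 + p * (2 * s / N))) volume ^ (2 + p * (2 * s / N)) ≤
        C * energyNorm s v ^ 2 * eLpNorm v (ENNReal.ofReal p) volume ^ (p * (2 * s / N)) := by
  obtain ⟨C, hC⟩ := exists_sq_le_mul_fibreEnergy hN hs
  set θ := 2 * s / N
  have hθ0 : 0 ≤ θ := by positivity
  set e := 2 + p * θ
  have he0 : 0 < e := by positivity
  refine ⟨2 ^ e * C, fun v hv hvp => ?_⟩
  rw [eLpNorm_ofReal_rpow he0, ENNReal.rpow_mul, eLpNorm_ofReal_rpow hp, energyNorm_sq hv]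
  have hfin : ∫⁻ x, ‖v x‖ₑ ^ p ≠ ⊤ := by
    rw [← eLpNorm_ofReal_rpow hp]
    exact ENNReal.rpow_ne_top_of_nonneg hp.le hvp
  rcases eq_or_ne (∫⁻ x, ‖v x‖ₑ ^ p) 0 with hA0 | hA0
  · have hv0 : ∀ᵐ x, ‖v x‖ₑ ^ e = 0 := by
      filter_upwards [(lintegral_eq_zero_iff' (hv.enorm.pow_const p)).1 hA0] with x hx
      rw [(ENNReal.rpow_eq_zero_iff_of_pos hp).1 hx, ENNReal.zero_rpow_of_pos he0]
    simp [lintegral_congr_ae hv0]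
  have hAtop := ENNReal.rpow_ne_top_of_nonneg hθ0 hfin
  calc ∫⁻ x, ‖v x‖ₑ ^ e = ∫⁻ x, 2 ^ e * (‖v x‖ₑ / 2) ^ e := by
        simp only [← ENNReal.mul_rpow_of_nonneg _ _ he0.le,
          ENNReal.mul_div_cancel two_ne_zero ENNReal.ofNat_ne_top]
    _ = 2 ^ e * ∫⁻ x, (‖v x‖ₑ / 2) ^ e :=
        lintegral_const_mul' _ _ (ENNReal.rpow_ne_top_of_nonneg he0.le ENNReal.ofNat_ne_top)
    _ ≤ 2 ^ e * ∫⁻ x, C * (∫⁻ y, ‖v y‖ₑ ^ p) ^ θ * fibreEnergy s v x := by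
        gcongr with x
        exact enorm_div_two_rpow_le hθ0 hp (hC v x) hv hfin hA0
    _ = 2 ^ e * (C * (∫⁻ y, ‖v y‖ₑ ^ p) ^ θ * energy s v) := by
        rw [lintegral_const_mul' _ _ (ENNReal.mul_ne_top ENNReal.coe_ne_top hAtop)]
        rfl
    _ = _ := by
        push_cast [ENNReal.coe_rpow_of_nonneg _ he0.le]
        ring

theorem SobolevInequality.bootstrap (hN : 1 ≤ N) (hs : 0 ≤ s) (hp : 0 < p)
    (hW : ∀ v ∈ W, AEMeasurable v ∧ energyNorm s v ≠ ⊤) (h : SobolevInequality W s p) :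
    SobolevInequality W s (2 + p * (2 * s / N)) := by
  obtain ⟨C, hC⟩ := h
  obtain ⟨C', hC'⟩ := exists_eLpNorm_rpow_le hN hs hp
  set e := p * (2 * s / N)
  have he : 0 ≤ e := by positivity
  refine .of_rpow_le (r := 2 + e) (by positivity) (C := C' * (C : ℝ≥0∞) ^ e)
    (by finiteness) fun v hv => ?_
  have hfin := ne_top_of_le_ne_top (ENNReal.mul_ne_top ENNReal.coe_ne_top (hW v hv).2) (hC v hv)
  calc eLpNorm v (ENNReal.ofReal (2 + e)) volume ^ (2 + e)
      ≤ C' * energyNorm s v ^ 2 * eLpNorm v (ENNReal.ofReal p) volume ^ e := hC' v (hW v hv).1 hfin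
    _ ≤ C' * energyNorm s v ^ 2 * (C * energyNorm s v) ^ e := by
        gcongr
        exact hC v hv
    _ = C' * (C : ℝ≥0∞) ^ e * energyNorm s v ^ (2 + e) := by
        rw [ENNReal.mul_rpow_of_nonneg _ _ he, ENNReal.rpow_add_of_nonneg _ _ zero_le_two he,
          ENNReal.rpow_two]
        ring

theorem SobolevInequality.interpolate {a b : ℝ} (ha : 0 < a) (hap : a ≤ p) (hpb : p ≤ b)
    (hW : ∀ v ∈ W, AEMeasurable v) (h₁ : SobolevInequality W s a) (h₂ : SobolevInequality W s b) :
    SobolevInequality W s p := by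
  obtain ⟨C₁, hC₁⟩ := h₁
  obtain ⟨C₂, hC₂⟩ := h₂
  have hb : 0 < b := by linarith
  have hp : 0 < p := by linarith
  obtain ⟨θ, μ, hθ, hμ, hθμ, hsum⟩ : p ∈ segment ℝ a b := by
    rw [segment_eq_Icc (hap.trans hpb)]
    exact ⟨hap, hpb⟩
  simp only [smul_eq_mul, mul_comm _ a, mul_comm _ b] at hsum
  have haθ : 0 ≤ a * θ := by positivity
  have hbμ : 0 ≤ b * μ := by positivity
  refine .of_rpow_le hp (C := (C₁ : ℝ≥0∞) ^ (a * θ) * (C₂ : ℝ≥0∞) ^ (b * μ)) (by finiteness)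
    fun v hv => ?_
  have hmeas : ∀ r : ℝ, AEMeasurable fun x => ‖v x‖ₑ ^ r := fun r => (hW v hv).enorm.pow_const r
  calc eLpNorm v (ENNReal.ofReal p) volume ^ p
      = ∫⁻ x, (‖v x‖ₑ ^ a) ^ θ * (‖v x‖ₑ ^ b) ^ μ := by
        rw [eLpNorm_ofReal_rpow hp]
        simp only [← hsum, ENNReal.rpow_add_of_nonneg _ _ haθ hbμ, ENNReal.rpow_mul]
    _ ≤ (∫⁻ x, ‖v x‖ₑ ^ a) ^ θ * (∫⁻ x, ‖v x‖ₑ ^ b) ^ μ :=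
        ENNReal.lintegral_mul_norm_pow_le (hmeas a) (hmeas b) hθ hμ hθμ
    _ = eLpNorm v (ENNReal.ofReal a) volume ^ (a * θ) *
          eLpNorm v (ENNReal.ofReal b) volume ^ (b * μ) := by
        rw [← eLpNorm_ofReal_rpow ha, ← eLpNorm_ofReal_rpow hb, ENNReal.rpow_mul, ENNReal.rpow_mul]
    _ ≤ (C₁ * energyNorm s v) ^ (a * θ) * (C₂ * energyNorm s v) ^ (b * μ) := by
        gcongr
        exacts [hC₁ v hv, hC₂ v hv]
    _ = (C₁ : ℝ≥0∞) ^ (a * θ) * (C₂ : ℝ≥0∞) ^ (b * μ) * energyNorm s v ^ p := by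
        rw [← hsum, ENNReal.rpow_add_of_nonneg _ _ haθ hbμ, ENNReal.mul_rpow_of_nonneg _ _ haθ,
          ENNReal.mul_rpow_of_nonneg _ _ hbμ]
        ring

theorem SobolevInequality.of_le {W : Set (Space 1 → ℝ)} {a : ℝ} (hs : 1 / 2 ≤ s) (ha : 0 < a)
    (hap : a ≤ p) (hW : ∀ v ∈ W, AEMeasurable v ∧ energyNorm s v ≠ ⊤)
    (h : SobolevInequality W s a) : SobolevInequality W s p := by
  have hlarge : ∀ n : ℕ, ∃ b, 0 < b ∧ a + 2 * n ≤ b ∧ SobolevInequality W s b := by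
    intro n
    induction n with
    | zero => exact ⟨a, ha, by simp, h⟩
    | succ n ih =>
      obtain ⟨b, hb, hab, hWb⟩ := ih
      refine ⟨_, ?_, ?_, hWb.bootstrap le_rfl (by linarith) hb hW⟩
      · have : 0 ≤ s := by linarith
        positivity
      · push_cast
        nlinarith
  obtain ⟨n, hn⟩ := exists_nat_ge p
  obtain ⟨b, -, hab, hWb⟩ := hlarge n
  have : (0 : ℝ) ≤ n := n.cast_nonneg
  exact .interpolate ha hap (by linarith) (fun v hv => (hW v hv).1) h hWb

theorem SobolevInequality.completion (h : SobolevInequality {φ | IsTestFunction Ω φ} s p) :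
    SobolevInequality (D0 Ω s) s p := by
  obtain ⟨C, hC⟩ := h
  refine ⟨C, fun v hv => ?_⟩
  obtain ⟨φ, hφ, hlim, hae⟩ := mem_D0_iff.1 hv
  have hφm := fun n => (hφ n).aemeasurable
  have hbound : Tendsto (fun n => C * (energyNorm s v + energyNorm s (φ n - v))) atTop
      (𝓝 (C * energyNorm s v)) := by
    simpa using ENNReal.Tendsto.const_mul (hlim.const_add (energyNorm s v))
      (Or.inr (ENNReal.coe_ne_top (r := C)))
  calc eLpNorm v (ENNReal.ofReal p) volume
      ≤ liminf (fun n => eLpNorm (φ n) (ENNReal.ofReal p) volume) atTop :=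
        Lp.eLpNorm_lim_le_liminf_eLpNorm (fun n => (hφm n).aestronglyMeasurable) v hae
    _ ≤ liminf (fun n => C * (energyNorm s v + energyNorm s (φ n - v))) atTop := by
        refine liminf_le_liminf (Eventually.of_forall fun n => (hC _ (hφ n)).trans ?_)
        gcongr
        exact energyNorm_le_add_energyNorm_sub (hφm n) (D0.aemeasurable hv)
    _ = C * energyNorm s v := hbound.liminf_eq

theorem sobolevInequality_sobolevConj (hN : 1 ≤ N) (hs : 0 ≤ s) (hsN : 2 * s < N) :
    SobolevInequality (D0 Ω s) s (2 * N / (N - 2 * s)) := by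
  have : (0 : ℝ) < N := by exact_mod_cast hN
  have hd : 0 < (N : ℝ) - 2 * s := by linarith
  set p : ℝ := 2 * N / (N - 2 * s) with hp
  have hp0 : 0 < p := by positivity
  obtain ⟨C, hC⟩ := exists_eLpNorm_rpow_le hN hs hp0
  have hfix : 2 + p * (2 * s / N) = p := by
    rw [hp]
    field_simp
    ring
  refine .completion (.of_rpow_le two_pos (ENNReal.coe_ne_top (r := C)) fun v hv => ?_)
  have hfin : eLpNorm v (ENNReal.ofReal p) volume ≠ ⊤ :=
    (hv.1.continuous.memLp_of_hasCompactSupport hv.2.1).2.ne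
  rcases eq_or_ne (eLpNorm v (ENNReal.ofReal p) volume) 0 with h0 | h0
  · rw [h0, ENNReal.zero_rpow_of_pos two_pos]
    exact zero_le
  have hGN := hC v hv.aemeasurable hfin
  rw [hfix] at hGN
  nth_rw 2 [← hfix] at hGN
  rw [ENNReal.rpow_add _ _ h0 hfin] at hGN
  rw [ENNReal.rpow_two (energyNorm s v)]
  exact (ENNReal.mul_le_mul_iff_left (ENNReal.rpow_pos (pos_iff_ne_zero.2 h0) hfin).ne'
    (ENNReal.rpow_ne_top_of_nonneg (by positivity) hfin)).1 hGN

end SobolevInequality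

section CompactEmbedding

variable {N : ℕ} {s q : ℝ} {v : Space N → ℝ} {Ω : Set (Space N)}

theorem exists_mem_D0_normLq_eq {n : ℕ} (hv : v ∈ D0 Ω s) (hfin : normLq Ω q v ≠ ⊤)
    (hlt : n * energyNorm s v < normLq Ω q v) :
    ∃ w ∈ D0 Ω s, energyNorm s w ≤ 1 ∧ normLq Ω q w = n := by
  have hpos : normLq Ω q v ≠ 0 := (pos_of_gt hlt).ne'
  have hscale : ‖(n : ℝ) / (normLq Ω q v).toReal‖ₑ = n / normLq Ω q v := by
    rw [Real.enorm_eq_ofReal (by positivity),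
      ENNReal.ofReal_div_of_pos (ENNReal.toReal_pos hpos hfin), ENNReal.ofReal_natCast,
      ENNReal.ofReal_toReal hfin]
  refine ⟨((n : ℝ) / (normLq Ω q v).toReal) • v, D0.const_smul hv _, ?_, ?_⟩
  · rw [energyNorm_const_smul, hscale, ← ENNReal.mul_div_right_comm]
    exact ENNReal.div_le_of_le_mul (by simpa using hlt.le)
  · rw [normLq, eLpNorm_const_smul, ← normLq, hscale, ENNReal.div_mul_cancel hpos hfin]

theorem CompactEmbedding.sobolevInequality (hq : 1 ≤ q) (h : CompactEmbedding Ω s q) :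
    SobolevInequality (D0 Ω s) s q := by
  by_contra hunbounded
  have hlarge : ∀ n : ℕ, ∃ w ∈ D0 Ω s, energyNorm s w ≤ 1 ∧ normLq Ω q w = n := by
    intro n
    simp only [SobolevInequality, not_exists, not_forall, not_le] at hunbounded
    obtain ⟨v, hv, hlt⟩ := hunbounded n
    rw [← normLq_eq_eLpNorm hv, ENNReal.coe_natCast] at hlt
    exact exists_mem_D0_normLq_eq hv (h.1 v hv).2.ne hlt
  choose w hwD hwE hwn using hlarge
  have henergy : ∀ n, energy s (w n) ≤ ENNReal.ofReal 1 := fun n => by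
    rw [← energyNorm_sq (D0.aemeasurable (hwD n)), ENNReal.ofReal_one]
    exact pow_le_one₀ zero_le (hwE n)
  obtain ⟨v, hv, k, hk, hlim⟩ := h.2 w hwD ⟨1, henergy⟩
  obtain ⟨m, hm⟩ := ENNReal.exists_nat_gt (ENNReal.add_ne_top.2 ⟨ENNReal.one_ne_top, hv.2.ne⟩)
  obtain ⟨n, hn, hmn⟩ :=
    ((ENNReal.tendsto_nhds_zero.1 hlim 1 one_pos).and (eventually_ge_atTop m)).exists
  have hle : normLq Ω q (w (k n)) ≤ 1 + normLq Ω q v := by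
    have := eLpNorm_add_le ((h.1 _ (hwD (k n))).1.sub hv.1) hv.1 (ENNReal.one_le_ofReal.2 hq)
    rw [sub_add_cancel] at this
    exact this.trans (add_le_add_left hn _)
  rw [hwn] at hle
  exact (hm.trans_le (by exact_mod_cast hmn.trans (hk.id_le n))).not_ge hle

end CompactEmbedding

section DeGiorgi

variable {α : Type*} [MeasurableSpace α] {μ : Measure α} {f : α → ℝ} {p q : ℝ} {A : ℝ≥0∞}

theorem tendsto_zero_of_le_mul_pow_mul_rpow {Y : ℕ → ℝ≥0∞} {C b η M : ℝ≥0∞} {γ : ℝ} (hγ : 1 ≤ γ)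
    (hη : η < 1) (hM : M ≠ ⊤) (hbη : b * η ^ (γ - 1) ≤ 1) (hCM : C * M ^ (γ - 1) ≤ η)
    (h0 : Y 0 ≤ M) (hstep : ∀ n, Y (n + 1) ≤ C * b ^ n * Y n ^ γ) :
    Tendsto Y atTop (𝓝 0) := by
  have hsplit : ∀ x : ℝ≥0∞, x ^ γ = x * x ^ (γ - 1) := fun x => by
    nth_rw 2 [← ENNReal.rpow_one x]
    rw [← ENNReal.rpow_add_of_nonneg _ _ zero_le_one (by linarith), add_sub_cancel]
  have hpow : ∀ n : ℕ, (η ^ n) ^ (γ - 1) = (η ^ (γ - 1)) ^ n := fun n => by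
    rw [← ENNReal.rpow_natCast, ← ENNReal.rpow_mul, mul_comm, ENNReal.rpow_mul_natCast]
  have hdecay : ∀ n, Y n ≤ M * η ^ n := by
    intro n
    induction n with
    | zero => simpa using h0
    | succ n ih =>
      calc Y (n + 1) ≤ C * b ^ n * Y n ^ γ := hstep n
        _ ≤ C * b ^ n * (M * η ^ n) ^ γ := by gcongr
        _ = C * M ^ (γ - 1) * (b * η ^ (γ - 1)) ^ n * (M * η ^ n) := by
          rw [hsplit, ENNReal.mul_rpow_of_nonneg _ _ (by linarith), hpow]
          ring
        _ ≤ η * 1 ^ n * (M * η ^ n) := by gcongr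
        _ = M * η ^ (n + 1) := by ring
  refine tendsto_of_tendsto_of_tendsto_of_le_of_le tendsto_const_nhds ?_ (fun _ => zero_le) hdecay
  simpa using ENNReal.Tendsto.const_mul (ENNReal.tendsto_pow_atTop_nhds_zero_of_lt_one hη)
    (Or.inr hM)

/-- The integral `∫ f₊^{q-1} (f - k)₊ dμ`, which measures the part of `f` above the level `k`. It is
the right-hand side of the equation for an eigenfunction `f`, tested against `(f - k)₊`. -/
noncomputable def levelIntegral (μ : Measure α) (f : α → ℝ) (q k : ℝ) : ℝ≥0∞ :=
  ∫⁻ x, ENNReal.ofReal (f x) ^ (q - 1) * ENNReal.ofReal (f x - k) ∂μ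

/-- The reverse inequality on which De Giorgi's iteration runs: the `Lᵖ` norm of `f` above a level
`l` is controlled by the level integral at any lower level `k`. Leaving room between the two
levels allows the truncation `(f - k)₊` to be smoothed. -/
def TruncationInequality (μ : Measure α) (f : α → ℝ) (p q : ℝ) (A : ℝ≥0∞) : Prop :=
  ∀ k l, 0 ≤ k → k < l →
    ∫⁻ x, ENNReal.ofReal (f x - l) ^ p ∂μ ≤ (A * levelIntegral μ f q k) ^ (p / 2)

theorem rpow_mul_sub_le_mul_sub_rpow {δ l K t : ℝ} (hq : 1 ≤ q) (hqp : q ≤ p) (hδ : 0 < δ)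
    (hl : 0 ≤ l) (hlK : l + δ ≤ K) (ht : l + δ ≤ t) :
    t ^ (q - 1) * (t - (l + δ)) ≤ (K / δ) ^ (q - 1) * δ ^ (q - p) * (t - l) ^ p := by
  have ht0 : 0 < t - l := by linarith
  have hK : 0 < K := by linarith
  have htK : t ≤ K / δ * (t - l) := by
    rw [div_mul_eq_mul_div, le_div_iff₀ hδ]
    nlinarith
  have hgap : (t - l) ^ q ≤ δ ^ (q - p) * (t - l) ^ p := by
    have : (t - l) ^ (q - p) ≤ δ ^ (q - p) :=
      Real.rpow_le_rpow_of_nonpos hδ (by linarith) (by linarith)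
    calc (t - l) ^ q = (t - l) ^ (q - p) * (t - l) ^ p := by
          rw [← Real.rpow_add ht0, sub_add_cancel]
      _ ≤ δ ^ (q - p) * (t - l) ^ p := by gcongr
  calc t ^ (q - 1) * (t - (l + δ)) ≤ (K / δ * (t - l)) ^ (q - 1) * (t - l) := by
        have : 0 ≤ t := by linarith
        have : 0 ≤ q - 1 := by linarith
        gcongr
        linarith
    _ = (K / δ) ^ (q - 1) * (t - l) ^ q := by
        rw [Real.mul_rpow (by positivity) ht0.le, mul_assoc, ← Real.rpow_add_one ht0.ne',
          sub_add_cancel]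
    _ ≤ (K / δ) ^ (q - 1) * (δ ^ (q - p) * (t - l) ^ p) := by gcongr
    _ = _ := (mul_assoc _ _ _).symm

theorem levelIntegral_add_le {δ l K : ℝ} (hq : 1 ≤ q) (hqp : q ≤ p) (hδ : 0 < δ) (hl : 0 ≤ l)
    (hlK : l + δ ≤ K) :
    levelIntegral μ f q (l + δ) ≤ ENNReal.ofReal ((K / δ) ^ (q - 1) * δ ^ (q - p)) *
      ∫⁻ x, ENNReal.ofReal (f x - l) ^ p ∂μ := by
  rw [levelIntegral, ← lintegral_const_mul' _ _ ENNReal.ofReal_ne_top]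
  refine lintegral_mono fun x => ?_
  rcases le_or_gt (f x) (l + δ) with h | h
  · rw [ENNReal.ofReal_of_nonpos (sub_nonpos.2 h), mul_zero]
    exact zero_le
  · have hK : 0 ≤ K := by linarith
    rw [ENNReal.ofReal_rpow_of_pos (by linarith), ENNReal.ofReal_rpow_of_pos (by linarith),
      ← ENNReal.ofReal_mul (Real.rpow_nonneg (by linarith) _), ← ENNReal.ofReal_mul (by positivity)]
    exact ENNReal.ofReal_le_ofReal (rpow_mul_sub_le_mul_sub_rpow hq hqp hδ hl hlK h.le)

theorem div_rpow_mul_rpow_eq {K : ℝ} (hK : 0 < K) (n : ℕ) :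
    (K / (K / (4 * 2 ^ n))) ^ (q - 1) * (K / (4 * 2 ^ n)) ^ (q - p) =
      4 ^ (p - 1) * K ^ (q - p) * (2 ^ (p - 1)) ^ n := by
  have hpow : ((2 : ℝ) ^ (p - 1)) ^ n = (2 ^ n) ^ (p - 1) := by
    rw [← Real.rpow_natCast (2 ^ (p - 1)), ← Real.rpow_mul zero_le_two, mul_comm (p - 1),
      Real.rpow_mul zero_le_two, Real.rpow_natCast]
  rw [div_div_cancel₀ hK.ne', Real.div_rpow hK.le (by positivity), hpow, mul_right_comm,
    ← Real.mul_rpow (by positivity) (by positivity), ← mul_div_assoc, mul_div_right_comm,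
    ← Real.rpow_sub (by positivity)]
  ring_nf

theorem TruncationInequality.levelIntegral_succ_le {K : ℝ} (h : TruncationInequality μ f p q A)
    (hq : 1 ≤ q) (hqp : q ≤ p) (hK : 0 < K) (n : ℕ) :
    levelIntegral μ f q (K * (1 - (1 / 2) ^ (n + 1))) ≤
      ENNReal.ofReal (4 ^ (p - 1) * K ^ (q - p)) * A ^ (p / 2) * ENNReal.ofReal (2 ^ (p - 1)) ^ n *
        levelIntegral μ f q (K * (1 - (1 / 2) ^ n)) ^ (p / 2) := by
  set k := K * (1 - (1 / 2) ^ n) with hk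
  set δ := K / (4 * 2 ^ n) with hδ
  have hδ0 : 0 < δ := by positivity
  have hk0 : 0 ≤ k :=
    mul_nonneg hK.le (sub_nonneg.2 (pow_le_one₀ (by norm_num) (by norm_num)))
  have hnext : K * (1 - (1 / 2) ^ (n + 1)) = k + δ + δ := by
    rw [hk, hδ, pow_succ, one_div_pow]
    field_simp
    ring
  have hnextK : k + δ + δ ≤ K := by
    rw [← hnext]
    exact mul_le_of_le_one_right hK.le (sub_le_self _ (by positivity))
  calc levelIntegral μ f q (K * (1 - (1 / 2) ^ (n + 1)))
      ≤ ENNReal.ofReal ((K / δ) ^ (q - 1) * δ ^ (q - p)) *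
          ∫⁻ x, ENNReal.ofReal (f x - (k + δ)) ^ p ∂μ := by
        rw [hnext]
        exact levelIntegral_add_le hq hqp hδ0 (by positivity) hnextK
    _ ≤ ENNReal.ofReal ((K / δ) ^ (q - 1) * δ ^ (q - p)) *
          (A * levelIntegral μ f q k) ^ (p / 2) := by
        gcongr
        exact h k (k + δ) hk0 (by linarith)
    _ = _ := by
        rw [div_rpow_mul_rpow_eq hK n, ENNReal.ofReal_mul (by positivity),
          ENNReal.ofReal_pow (by positivity), ENNReal.mul_rpow_of_nonneg _ _ (by linarith)]
        ring

theorem levelIntegral_zero (hq : 1 ≤ q) :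
    levelIntegral μ f q 0 = ∫⁻ x, ENNReal.ofReal (f x) ^ q ∂μ := by
  refine lintegral_congr fun x => ?_
  rw [sub_zero]
  nth_rw 2 [← ENNReal.rpow_one (ENNReal.ofReal (f x))]
  rw [← ENNReal.rpow_add_of_nonneg _ _ (by linarith) zero_le_one, sub_add_cancel]

theorem ae_le_of_levelIntegral_eq_zero {K : ℝ} (hK : 0 ≤ K) (hf : AEMeasurable f μ)
    (h : levelIntegral μ f q K = 0) : ∀ᵐ x ∂μ, f x ≤ K := by
  have hmeas :
      AEMeasurable (fun x => ENNReal.ofReal (f x) ^ (q - 1) * ENNReal.ofReal (f x - K)) μ :=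
    (hf.ennreal_ofReal.pow_const _).mul (hf.sub_const K).ennreal_ofReal
  filter_upwards [(lintegral_eq_zero_iff' hmeas).1 h] with x hx
  rcases mul_eq_zero.1 hx with hx | hx
  · exact (ENNReal.ofReal_eq_zero.1 ((ENNReal.rpow_eq_zero_iff.1 hx).resolve_right
      fun h => ENNReal.ofReal_ne_top h.1).1).trans hK
  · exact sub_nonpos.1 (ENNReal.ofReal_eq_zero.1 hx)

theorem TruncationInequality.ae_le_of_mul_le {K : ℝ} {M : ℝ≥0∞} (h : TruncationInequality μ f p q A)
    (hp : 2 < p) (hq : 1 ≤ q) (hqp : q ≤ p) (hK : 0 < K) (hf : AEMeasurable f μ) (hM : M ≠ ⊤)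
    (hfM : ∫⁻ x, ENNReal.ofReal (f x) ^ q ∂μ ≤ M)
    (hsmall : ENNReal.ofReal (4 ^ (p - 1) * K ^ (q - p)) * A ^ (p / 2) * M ^ (p / 2 - 1) ≤
      ENNReal.ofReal (2 ^ (-(2 * (p - 1) / (p - 2))))) :
    ∀ᵐ x ∂μ, f x ≤ K := by
  have hp2 : p - 2 ≠ 0 := by linarith
  have hrate : (2 : ℝ) ^ (-(2 * (p - 1) / (p - 2))) < 1 :=
    Real.rpow_lt_one_of_one_lt_of_neg one_lt_two
      (neg_lt_zero.2 (div_pos (by linarith) (by linarith)))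
  have hbalance : ENNReal.ofReal (2 ^ (p - 1)) *
      ENNReal.ofReal (2 ^ (-(2 * (p - 1) / (p - 2)))) ^ (p / 2 - 1) ≤ 1 := by
    rw [ENNReal.ofReal_rpow_of_pos (by positivity), ← ENNReal.ofReal_mul (by positivity),
      ← Real.rpow_mul zero_le_two, ← Real.rpow_add two_pos]
    have : p - 1 + -(2 * (p - 1) / (p - 2)) * (p / 2 - 1) = 0 := by
      field_simp
      ring
    rw [this, Real.rpow_zero, ENNReal.ofReal_one]
  have hlim := tendsto_zero_of_le_mul_pow_mul_rpow
    (Y := fun n => levelIntegral μ f q (K * (1 - (1 / 2) ^ n))) (by linarith)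
    (ENNReal.ofReal_lt_one.2 hrate) hM hbalance hsmall
    (by simpa [levelIntegral_zero hq] using hfM) (h.levelIntegral_succ_le hq hqp hK)
  refine ae_le_of_levelIntegral_eq_zero (q := q) hK.le hf
    (le_zero_iff.1 (ge_of_tendsto' hlim fun n => lintegral_mono fun x => ?_))
  have : K * (1 - (1 / 2) ^ n) ≤ K := mul_le_of_le_one_right hK.le (sub_le_self _ (by positivity))
  gcongr

/-- The constant of De Giorgi's iteration: with this factor, the smallness condition on the initial
level integral holds with equality. -/
noncomputable def deGiorgiConst (p q : ℝ) : ℝ :=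
  2 ^ (2 * (p - 1) ^ 2 / ((p - 2) * (p - q)))

theorem deGiorgiConst_rpow_mul (hp : 2 < p) (hqp : q < p) :
    4 ^ (p - 1) * deGiorgiConst p q ^ (q - p) = 2 ^ (-(2 * (p - 1) / (p - 2))) := by
  have hp2 : p - 2 ≠ 0 := by linarith
  have hpq : p - q ≠ 0 := by linarith
  have h4 : (4 : ℝ) = 2 ^ (2 : ℝ) := by norm_num
  rw [deGiorgiConst, ← Real.rpow_mul zero_le_two, h4, ← Real.rpow_mul zero_le_two,
    ← Real.rpow_add two_pos]
  congr 1
  field_simp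
  ring

theorem TruncationInequality.ae_le {a σ : ℝ}
    (h : TruncationInequality μ f p q (ENNReal.ofReal (σ * a ^ (2 - q)))) (hp : 2 < p) (hq : 1 ≤ q)
    (hqp : q < p) (ha : 0 < a) (hσ : 0 < σ) (hf : AEMeasurable f μ)
    (hfa : ∫⁻ x, ENNReal.ofReal (f x) ^ q ∂μ ≤ ENNReal.ofReal a ^ q) :
    ∀ᵐ x ∂μ, f x ≤ deGiorgiConst p q * σ ^ (p / (2 * (p - q))) * a := by
  have hc : 0 < deGiorgiConst p q := Real.rpow_pos_of_pos two_pos _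
  have hpq : p - q ≠ 0 := by linarith
  refine h.ae_le_of_mul_le hp hq hqp.le (by positivity) hf
    (ENNReal.rpow_ne_top_of_nonneg (by linarith) ENNReal.ofReal_ne_top) hfa (le_of_eq ?_)
  have hσpow : (σ ^ (p / (2 * (p - q)))) ^ (q - p) * σ ^ (p / 2) = 1 := by
    rw [← Real.rpow_mul hσ.le, ← Real.rpow_add hσ]
    have : p / (2 * (p - q)) * (q - p) + p / 2 = 0 := by
      field_simp
      ring
    rw [this, Real.rpow_zero]
  have hapow : a ^ (q - p) * (a ^ (2 - q)) ^ (p / 2) * (a ^ q) ^ (p / 2 - 1) = 1 := by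
    rw [← Real.rpow_mul ha.le, ← Real.rpow_mul ha.le, ← Real.rpow_add ha, ← Real.rpow_add ha]
    have : q - p + (2 - q) * (p / 2) + q * (p / 2 - 1) = 0 := by ring
    rw [this, Real.rpow_zero]
  rw [ENNReal.ofReal_rpow_of_pos (by positivity), ENNReal.ofReal_rpow_of_pos ha,
    ENNReal.ofReal_rpow_of_pos (by positivity), ← ENNReal.ofReal_mul (by positivity),
    ← ENNReal.ofReal_mul (by positivity), ← deGiorgiConst_rpow_mul hp hqp,
    Real.mul_rpow (by positivity) ha.le, Real.mul_rpow hc.le (by positivity),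
    Real.mul_rpow hσ.le (by positivity)]
  congr 1
  linear_combination 4 ^ (p - 1) * deGiorgiConst p q ^ (q - p) *
    (a ^ (q - p) * (a ^ (2 - q)) ^ (p / 2) * (a ^ q) ^ (p / 2 - 1) * hσpow + hapow)

end DeGiorgi

section SmoothTruncation

variable {k l : ℝ}

/-- A smooth monotone contraction lying between the truncations `(t - l)₊` and `(t - k)₊`, for
`k < l`. Unlike these, it maps test functions to test functions. -/
noncomputable def smoothTruncation (k l t : ℝ) : ℝ :=
  ∫ τ in k..t, Real.smoothTransition ((τ - k) / (l - k))

theorem continuous_smoothTransition_div (k l : ℝ) :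
    Continuous fun τ : ℝ => Real.smoothTransition ((τ - k) / (l - k)) :=
  Real.smoothTransition.continuous.comp ((continuous_id.sub continuous_const).div_const _)

theorem hasDerivAt_smoothTruncation (k l t : ℝ) :
    HasDerivAt (smoothTruncation k l) (Real.smoothTransition ((t - k) / (l - k))) t :=
  ((continuous_smoothTransition_div k l).integral_hasStrictDerivAt k t).hasDerivAt

theorem deriv_smoothTruncation (k l : ℝ) :
    deriv (smoothTruncation k l) = fun t => Real.smoothTransition ((t - k) / (l - k)) :=
  funext fun t => (hasDerivAt_smoothTruncation k l t).deriv

theorem differentiable_smoothTruncation (k l : ℝ) : Differentiable ℝ (smoothTruncation k l) :=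
  fun t => (hasDerivAt_smoothTruncation k l t).differentiableAt

theorem contDiff_smoothTruncation (k l : ℝ) : ContDiff ℝ ∞ (smoothTruncation k l) := by
  refine contDiff_infty_iff_deriv.2 ⟨differentiable_smoothTruncation k l, ?_⟩
  rw [deriv_smoothTruncation]
  exact Real.smoothTransition.contDiff.comp ((contDiff_id.sub contDiff_const).div_const _)

theorem lipschitzWith_smoothTruncation (k l : ℝ) : LipschitzWith 1 (smoothTruncation k l) := by
  refine lipschitzWith_of_nnnorm_deriv_le (differentiable_smoothTruncation k l) fun t => ?_
  rw [deriv_smoothTruncation, ← NNReal.coe_le_coe, coe_nnnorm, Real.norm_eq_abs,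
    abs_of_nonneg (Real.smoothTransition.nonneg _)]
  exact Real.smoothTransition.le_one _

theorem monotone_smoothTruncation (k l : ℝ) : Monotone (smoothTruncation k l) := by
  refine monotone_of_deriv_nonneg (differentiable_smoothTruncation k l) fun t => ?_
  rw [deriv_smoothTruncation]
  exact Real.smoothTransition.nonneg _

theorem smoothTruncation_of_le {t : ℝ} (hkl : k ≤ l) (ht : t ≤ k) : smoothTruncation k l t = 0 := by
  rw [smoothTruncation, intervalIntegral.integral_congr (g := fun _ => 0),
    intervalIntegral.integral_zero]
  intro τ hτ
  rw [uIcc_of_ge ht] at hτ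
  exact Real.smoothTransition.zero_of_nonpos
    (div_nonpos_of_nonpos_of_nonneg (sub_nonpos.2 hτ.2) (sub_nonneg.2 hkl))

theorem smoothTruncation_nonneg (hkl : k ≤ l) (t : ℝ) : 0 ≤ smoothTruncation k l t := by
  rcases le_total t k with h | h
  · exact (smoothTruncation_of_le hkl h).ge
  · exact (smoothTruncation_of_le hkl le_rfl).ge.trans (monotone_smoothTruncation k l h)

theorem abs_smoothTruncation_le (hkl : k ≤ l) (t : ℝ) : |smoothTruncation k l t| ≤ |t - k| := by
  have := (lipschitzWith_smoothTruncation k l).dist_le_mul t k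
  rwa [smoothTruncation_of_le hkl le_rfl, Real.dist_eq, Real.dist_eq, sub_zero, NNReal.coe_one,
    one_mul] at this

theorem sub_le_smoothTruncation (hkl : k < l) (t : ℝ) : t - l ≤ smoothTruncation k l t := by
  rcases le_total t l with h | h
  · exact (sub_nonpos.2 h).trans (smoothTruncation_nonneg hkl.le t)
  have hint := fun a b => (continuous_smoothTransition_div k l).intervalIntegrable
    (μ := volume) a b
  have hbeyond : ∫ τ in l..t, Real.smoothTransition ((τ - k) / (l - k)) = t - l := by
    rw [intervalIntegral.integral_congr (g := fun _ => 1), intervalIntegral.integral_const,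
      smul_eq_mul, mul_one]
    intro τ hτ
    rw [uIcc_of_le h] at hτ
    refine Real.smoothTransition.one_of_one_le ((one_le_div (sub_pos.2 hkl)).2 ?_)
    linarith [hτ.1]
  rw [smoothTruncation, ← intervalIntegral.integral_add_adjacent_intervals (hint k l) (hint l t),
    hbeyond]
  exact le_add_of_nonneg_left (smoothTruncation_nonneg hkl.le l)

theorem enorm_rpow_mul_smoothTruncation_le (hk : 0 ≤ k) (hkl : k ≤ l) (q t : ℝ) :
    ‖|t| ^ (q - 2) * t * smoothTruncation k l t‖ₑ ≤
      ENNReal.ofReal t ^ (q - 1) * ENNReal.ofReal (t - k) := by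
  rcases le_or_gt t k with h | h
  · rw [smoothTruncation_of_le hkl h, mul_zero, enorm_zero]
    exact zero_le
  have ht : 0 < t := hk.trans_lt h
  have hpow : |t| ^ (q - 2) * t = t ^ (q - 1) := by
    rw [abs_of_pos ht, ← Real.rpow_add_one ht.ne']
    ring_nf
  rw [hpow, enorm_mul, Real.enorm_of_nonneg (by positivity), ENNReal.ofReal_rpow_of_pos ht,
    Real.enorm_eq_ofReal_abs]
  gcongr
  exact (abs_smoothTruncation_le hkl t).trans_eq (abs_of_pos (sub_pos.2 h))

end SmoothTruncation

section Eigenfunctions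

variable {N : ℕ} {s p q lam : ℝ} {u : Space N → ℝ} {Ω : Set (Space N)} {C : NNReal}

theorem IsEigenfunction.neg (hu : IsEigenfunction Ω s q lam u) :
    IsEigenfunction Ω s q lam (-u) := by
  refine ⟨D0.neg hu.1, fun h0 => hu.2.1 ?_, fun φ hφ => ?_⟩
  · filter_upwards [h0] with x hx using neg_eq_zero.1 hx
  · have hform : energyForm s (-u) φ = -energyForm s u φ := by
      simp only [energyForm, ← integral_neg, Pi.neg_apply]
      congr! 4
      ring
    have hnorm : normLq Ω q (-u) = normLq Ω q u := eLpNorm_neg _ _ _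
    simp only [hform, hnorm, hu.2.2 φ hφ, Pi.neg_apply, abs_neg, mul_neg, neg_mul, integral_neg]

theorem IsEigenfunction.eLpNorm_ne_zero (hu : IsEigenfunction Ω s q lam u) (hp : 0 < p) :
    eLpNorm u (ENNReal.ofReal p) volume ≠ 0 := fun h =>
  hu.2.1 ((eLpNorm_eq_zero_iff (D0.aemeasurable hu.1).aestronglyMeasurable
    (ENNReal.ofReal_pos.2 hp).ne').1 h)

theorem IsEigenfunction.sq_energyNorm_comp_le (hs0 : 0 < s) (hs1 : s < 1)
    (hu : IsEigenfunction Ω s q lam u) {G : ℝ → ℝ} (hG : ContDiff ℝ ∞ G) (hG0 : G 0 = 0)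
    (hGL : LipschitzWith 1 G) (hGmono : Monotone G) :
    energyNorm s (G ∘ u) ^ 2 ≤ ENNReal.ofReal (lam * (normLq Ω q u).toReal ^ (2 - q) *
      ∫ x in Ω, |u x| ^ (q - 2) * u x * G (u x)) := by
  refine (sq_energyNorm_comp_le_energyForm hGL hGmono (D0.aemeasurable hu.1)
    (D0.energyNorm_ne_top hs0 hs1 hu.1)).trans_eq ?_
  rw [hu.2.2 _ (D0.comp hs0 hs1 hG hG0 hGL hu.1)]
  rfl

theorem IsEigenfunction.lam_pos (hs0 : 0 < s) (hs1 : s < 1) (hp : 0 < p)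
    (hu : IsEigenfunction Ω s q lam u)
    (hC : ∀ v ∈ D0 Ω s, eLpNorm v (ENNReal.ofReal p) volume ≤ C * energyNorm s v) :
    0 < lam := by
  by_contra! hlam
  have hmass : 0 ≤ ∫ x in Ω, |u x| ^ (q - 2) * u x * u x := integral_nonneg fun x => by
    rw [Pi.zero_apply, mul_assoc]
    exact mul_nonneg (by positivity) (mul_self_nonneg _)
  have henergy : energyNorm s u ^ 2 ≤ 0 := by
    refine (hu.sq_energyNorm_comp_le hs0 hs1 contDiff_id rfl LipschitzWith.id monotone_id).trans_eq
      (ENNReal.ofReal_of_nonpos ?_)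
    exact mul_nonpos_of_nonpos_of_nonneg
      (mul_nonpos_of_nonpos_of_nonneg hlam (by positivity)) hmass
  have henergy0 : energyNorm s u = 0 := pow_eq_zero_iff two_ne_zero |>.1 (le_zero_iff.1 henergy)
  have := hC u hu.1
  rw [henergy0, mul_zero] at this
  exact hu.eLpNorm_ne_zero hp (le_zero_iff.1 this)

theorem IsEigenfunction.sq_energyNorm_smoothTruncation_le (hs0 : 0 < s) (hs1 : s < 1)
    (hu : IsEigenfunction Ω s q lam u) (hlam : 0 ≤ lam) {k l : ℝ} (hk : 0 ≤ k) (hkl : k ≤ l) :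
    energyNorm s (smoothTruncation k l ∘ u) ^ 2 ≤
      ENNReal.ofReal (lam * (normLq Ω q u).toReal ^ (2 - q)) * levelIntegral volume u q k := by
  refine (hu.sq_energyNorm_comp_le hs0 hs1 (contDiff_smoothTruncation k l)
    (smoothTruncation_of_le hkl hk) (lipschitzWith_smoothTruncation k l)
    (monotone_smoothTruncation k l)).trans ?_
  rw [ENNReal.ofReal_mul (by positivity)]
  gcongr
  calc ENNReal.ofReal (∫ x in Ω, |u x| ^ (q - 2) * u x * smoothTruncation k l (u x))
      ≤ ∫⁻ x in Ω, ‖|u x| ^ (q - 2) * u x * smoothTruncation k l (u x)‖ₑ :=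
        (Real.ofReal_le_enorm _).trans (enorm_integral_le_lintegral_enorm _)
    _ ≤ ∫⁻ x, ‖|u x| ^ (q - 2) * u x * smoothTruncation k l (u x)‖ₑ := setLIntegral_le_lintegral _ _
    _ ≤ levelIntegral volume u q k :=
        lintegral_mono fun x => enorm_rpow_mul_smoothTruncation_le hk hkl q (u x)

theorem IsEigenfunction.truncationInequality (hs0 : 0 < s) (hs1 : s < 1) (hp : 0 < p)
    (hu : IsEigenfunction Ω s q lam u) (hlam : 0 ≤ lam)
    (hC : ∀ v ∈ D0 Ω s, eLpNorm v (ENNReal.ofReal p) volume ≤ C * energyNorm s v) :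
    TruncationInequality volume u p q
      (ENNReal.ofReal (C ^ 2 * lam * (normLq Ω q u).toReal ^ (2 - q))) := by
  intro k l hk hkl
  set G := smoothTruncation k l
  have hGu : G ∘ u ∈ D0 Ω s := D0.comp hs0 hs1 (contDiff_smoothTruncation k l)
    (smoothTruncation_of_le hkl.le hk) (lipschitzWith_smoothTruncation k l) hu.1
  calc ∫⁻ x, ENNReal.ofReal (u x - l) ^ p ≤ ∫⁻ x, ‖(G ∘ u) x‖ₑ ^ p := by
        gcongr with x
        exact (ENNReal.ofReal_le_ofReal (sub_le_smoothTruncation hkl (u x))).trans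
          (Real.ofReal_le_enorm _)
    _ = eLpNorm (G ∘ u) (ENNReal.ofReal p) volume ^ p := (eLpNorm_ofReal_rpow hp).symm
    _ ≤ (C * energyNorm s (G ∘ u)) ^ p := by
        gcongr
        exact hC _ hGu
    _ = ((C : ℝ≥0∞) ^ 2 * energyNorm s (G ∘ u) ^ 2) ^ (p / 2) := by
        rw [← mul_pow, ← ENNReal.rpow_two, ← ENNReal.rpow_mul, mul_div_cancel₀ p two_ne_zero]
    _ ≤ ((C : ℝ≥0∞) ^ 2 * (ENNReal.ofReal (lam * (normLq Ω q u).toReal ^ (2 - q)) *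
          levelIntegral volume u q k)) ^ (p / 2) := by
        gcongr
        exact hu.sq_energyNorm_smoothTruncation_le hs0 hs1 hlam hk hkl.le
    _ = _ := by
        rw [← mul_assoc, mul_assoc ((C : ℝ) ^ 2),
          ENNReal.ofReal_mul (p := (C : ℝ) ^ 2) (by positivity),
          ENNReal.ofReal_pow C.coe_nonneg, ENNReal.ofReal_coe_nnreal]

theorem IsEigenfunction.ae_le (hs0 : 0 < s) (hs1 : s < 1) (hp : 2 < p) (hq : 1 ≤ q) (hqp : q < p)
    (hu : IsEigenfunction Ω s q lam u) (hfin : normLq Ω q u ≠ ⊤) (hC0 : 0 < C)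
    (hC : ∀ v ∈ D0 Ω s, eLpNorm v (ENNReal.ofReal p) volume ≤ C * energyNorm s v) :
    ∀ᵐ x, u x ≤
      deGiorgiConst p q * (C ^ 2 * lam) ^ (p / (2 * (p - q))) * (normLq Ω q u).toReal := by
  have hp0 : 0 < p := by linarith
  have hq0 : 0 < q := by linarith
  have hlam := hu.lam_pos hs0 hs1 hp0 hC
  have hnorm : 0 < (normLq Ω q u).toReal :=
    ENNReal.toReal_pos (normLq_eq_eLpNorm hu.1 ▸ hu.eLpNorm_ne_zero hq0) hfin
  refine (hu.truncationInequality hs0 hs1 hp0 hlam.le hC).ae_le hp hq hqp hnorm (by positivity)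
    (D0.aemeasurable hu.1) ?_
  rw [ENNReal.ofReal_toReal hfin, normLq_eq_eLpNorm hu.1, eLpNorm_ofReal_rpow hq0]
  gcongr
  exact Real.ofReal_le_enorm _

theorem SobolevInequality.exists_eLpNorm_top_le {W : Set (Space N → ℝ)} (hs0 : 0 < s) (hs1 : s < 1)
    (hp : 2 < p) (hq : 1 ≤ q) (hqp : q < p) (h : SobolevInequality W s p) :
    ∃ C : ℝ, 0 < C ∧ ∀ Ω, D0 Ω s ⊆ W → ∀ lam u, IsEigenfunction Ω s q lam u → normLq Ω q u ≠ ⊤ →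
      eLpNorm u ⊤ (volume.restrict Ω) ≤
        ENNReal.ofReal (C * lam ^ (p / (2 * (p - q)))) * normLq Ω q u := by
  obtain ⟨C, hC⟩ := h
  have hdG : 0 < deGiorgiConst p q := Real.rpow_pos_of_pos two_pos _
  refine ⟨deGiorgiConst p q * (((C + 1 : NNReal) : ℝ) ^ 2) ^ (p / (2 * (p - q))), by positivity,
    fun Ω hΩ lam u hu hfin => ?_⟩
  have hC' : ∀ v ∈ D0 Ω s,
      eLpNorm v (ENNReal.ofReal p) volume ≤ (C + 1 : NNReal) * energyNorm s v := fun v hv => by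
    refine (hC v (hΩ hv)).trans ?_
    gcongr
    exact le_self_add
  have hlam := hu.lam_pos hs0 hs1 (by linarith) hC'
  have hneg : normLq Ω q (-u) = normLq Ω q u := eLpNorm_neg _ _ _
  have hupper := hu.ae_le hs0 hs1 hp hq hqp hfin (by positivity) hC'
  have hlower := hu.neg.ae_le hs0 hs1 hp hq hqp (hneg ▸ hfin) (by positivity) hC'
  rw [hneg] at hlower
  rw [mul_assoc, ← Real.mul_rpow (by positivity) hlam.le, eLpNorm_exponent_top]
  nth_rw 1 [← ENNReal.ofReal_toReal hfin]
  rw [← ENNReal.ofReal_mul (by positivity)]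
  refine eLpNormEssSup_le_of_ae_bound (ae_restrict_of_ae ?_)
  filter_upwards [hupper, hlower] with x hx hx' using abs_le'.2 ⟨hx, hx'⟩

end Eigenfunctions

section CriticalExponent

variable {N : ℕ} {s : ℝ}

theorem sobolevConj_ne_top_iff : sobolevConj N s ≠ ⊤ ↔ 2 * s < N := by
  simp [sobolevConj]

theorem toReal_sobolevConj (hsN : 2 * s < N) :
    (sobolevConj N s).toReal = 2 * N / (N - 2 * s) := by
  rw [sobolevConj, if_pos hsN, ENNReal.toReal_ofReal]
  have : 0 < (N : ℝ) - 2 * s := by linarith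
  positivity

theorem two_lt_toReal_sobolevConj (hs0 : 0 < s) (hsN : 2 * s < N) :
    2 < (sobolevConj N s).toReal := by
  rw [toReal_sobolevConj hsN, lt_div_iff₀ (by linarith)]
  linarith

theorem eq_one_of_sobolevConj_eq_top (hN : 1 ≤ N) (hs1 : s < 1) (h : sobolevConj N s = ⊤) :
    N = 1 := by
  have hsN : (N : ℝ) ≤ 2 * s := not_lt.1 (mt sobolevConj_ne_top_iff.2 (not_not.2 h))
  have hN2 : (N : ℝ) < 2 := by linarith
  have : N < 2 := by exact_mod_cast hN2
  omega

theorem one_half_le_of_sobolevConj_eq_top (h : sobolevConj 1 s = ⊤) : 1 / 2 ≤ s := by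
  have hs : ((1 : ℕ) : ℝ) ≤ 2 * s := not_lt.1 (mt sobolevConj_ne_top_iff.2 (not_not.2 h))
  push_cast at hs
  linarith

end CriticalExponent

section BoundednessOfEigenfunctions

variable {N : ℕ} {s q : ℝ}

theorem exists_eLpNorm_top_le_of_two_mul_lt (hN : 1 ≤ N) (hs0 : 0 < s) (hs1 : s < 1)
    (hsN : 2 * s < N) (hq : 1 ≤ q) (hq' : q < (sobolevConj N s).toReal) :
    ∃ C : ℝ, 0 < C ∧ ∀ Ω : Set (Space N), ∀ lam u, IsEigenfunction Ω s q lam u →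
      normLq Ω q u ≠ ⊤ → eLpNorm u ⊤ (volume.restrict Ω) ≤
        ENNReal.ofReal (C * lam ^ ((sobolevConj N s).toReal /
          (2 * ((sobolevConj N s).toReal - q)))) * normLq Ω q u := by
  have hSob : SobolevInequality (D0 univ s) s (sobolevConj N s).toReal :=
    toReal_sobolevConj hsN ▸ sobolevInequality_sobolevConj hN hs0.le hsN
  obtain ⟨C, hC, h⟩ := hSob.exists_eLpNorm_top_le hs0 hs1 (two_lt_toReal_sobolevConj hs0 hsN) hq hq'
  exact ⟨C, hC, fun Ω => h Ω (D0_mono (subset_univ Ω))⟩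

theorem SobolevInequality.exists_eLpNorm_top_le_mul {W : Set (Space 1 → ℝ)} {a : ℝ}
    (hs1 : s < 1) (hs : 1 / 2 ≤ s) (hq : 1 < q) (ha : 0 < a) (haq : a ≤ 2 * q)
    (hW : W ⊆ D0 univ s) (h : SobolevInequality W s a) :
    ∃ C : ℝ, 0 < C ∧ ∀ Ω, D0 Ω s ⊆ W → ∀ lam u, IsEigenfunction Ω s q lam u →
      normLq Ω q u ≠ ⊤ →
        eLpNorm u ⊤ (volume.restrict Ω) ≤ ENNReal.ofReal (C * lam) * normLq Ω q u := by
  have hs0 : 0 < s := by linarith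
  have hSob : SobolevInequality W s (2 * q) := h.of_le hs ha haq fun v hv =>
    ⟨D0.aemeasurable (hW hv), D0.energyNorm_ne_top hs0 hs1 (hW hv)⟩
  have hexp : 2 * q / (2 * (2 * q - q)) = 1 := by
    rw [two_mul q, add_sub_cancel_right, ← two_mul]
    exact div_self (by linarith)
  simpa only [hexp, Real.rpow_one] using
    hSob.exists_eLpNorm_top_le hs0 hs1 (by linarith) hq.le (by linarith)

theorem sobolevInequality_two_of_volume_le {m : ℝ≥0∞} (hN : 1 ≤ N) (hs : 0 ≤ s) (hm : m ≠ ⊤) :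
    SobolevInequality {v : Space N → ℝ | ∃ Ω, volume Ω ≤ m ∧ v ∈ D0 Ω s} s 2 := by
  refine (sobolevInequality_two_of_volume_support_le hN hs hm).mono fun v ⟨Ω, hΩ, hv⟩ =>
    ⟨D0.aemeasurable hv, (measure_mono_ae ?_).trans hΩ⟩
  filter_upwards [D0.ae_eq_zero hv] with x hx hxv using by_contra fun hxΩ => hxv (hx hxΩ)

theorem D0.normLq_ne_top_of_volume_ne_top {Ω : Set (Space 1)} {u : Space 1 → ℝ} (hs1 : s < 1)
    (hs : 1 / 2 ≤ s) (hΩ : volume Ω ≠ ⊤) (hu : u ∈ D0 Ω s) : normLq Ω q u ≠ ⊤ := by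
  have hs0 : 0 < s := by linarith
  have : IsFiniteMeasure (volume.restrict Ω) := ⟨by simpa using hΩ.lt_top⟩
  have hTwo : SobolevInequality (D0 Ω s) s 2 :=
    (sobolevInequality_two_of_volume_le le_rfl hs0.le hΩ).mono fun v hv => ⟨Ω, le_rfl, hv⟩
  have hSob : SobolevInequality (D0 Ω s) s (max 2 q) :=
    hTwo.of_le hs two_pos (le_max_left 2 q) fun v hv =>
      ⟨D0.aemeasurable hv, D0.energyNorm_ne_top hs0 hs1 hv⟩
  have hmem : MemLp u (ENNReal.ofReal (max 2 q)) (volume.restrict Ω) :=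
    (hSob.memLp hu (D0.aemeasurable hu) (D0.energyNorm_ne_top hs0 hs1 hu)).restrict Ω
  exact (hmem.mono_exponent (ENNReal.ofReal_le_ofReal (le_max_right 2 q))).eLpNorm_ne_top

theorem exists_eLpNorm_top_le_mul_of_volume_le (hs1 : s < 1) (hs : 1 / 2 ≤ s) (hq : 1 < q)
    {m : ℝ≥0∞} (hm : m ≠ ⊤) :
    ∃ C : ℝ, 0 < C ∧ ∀ Ω : Set (Space 1), volume Ω ≤ m → ∀ lam u, IsEigenfunction Ω s q lam u →
      eLpNorm u ⊤ (volume.restrict Ω) ≤ ENNReal.ofReal (C * lam) * normLq Ω q u := by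
  have hSob := sobolevInequality_two_of_volume_le (N := 1) (s := s) le_rfl (by linarith) hm
  obtain ⟨C, hC, h⟩ := hSob.exists_eLpNorm_top_le_mul hs1 hs hq two_pos (by linarith)
    (by rintro v ⟨Ω, -, hv⟩; exact D0_mono (subset_univ Ω) hv)
  exact ⟨C, hC, fun Ω hΩ lam u hu => h Ω (fun v hv => ⟨Ω, hΩ, hv⟩) lam u hu
    (D0.normLq_ne_top_of_volume_ne_top hs1 hs (ne_top_of_le_ne_top hm hΩ) hu.1)⟩

theorem SobolevInequality.exists_eLpNorm_top_le_mul_of_D0 {Ω : Set (Space 1)} (hs1 : s < 1)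
    (hs : 1 / 2 ≤ s) (hq : 1 < q) (h : SobolevInequality (D0 Ω s) s q) :
    ∃ C : ℝ, 0 < C ∧ ∀ lam u, IsEigenfunction Ω s q lam u →
      eLpNorm u ⊤ (volume.restrict Ω) ≤ ENNReal.ofReal (C * lam) * normLq Ω q u := by
  obtain ⟨C, hC, hbound⟩ := h.exists_eLpNorm_top_le_mul hs1 hs hq (by linarith) (by linarith)
    (D0_mono (subset_univ Ω))
  refine ⟨C, hC, fun lam u hu => hbound Ω Subset.rfl lam u hu ?_⟩
  exact ((h.memLp hu.1 (D0.aemeasurable hu.1)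
    (D0.energyNorm_ne_top (by linarith) hs1 hu.1)).restrict Ω).eLpNorm_ne_top

end BoundednessOfEigenfunctions

end FracSemilinear

open FracSemilinear in
theorem mainTheorem8_general (N : ℕ) (hN : 1 ≤ N) (s q : ℝ) (hs0 : 0 < s) (hs1 : s < 1)
    (hq1 : 1 < q) (hq2 : ENNReal.ofReal q < sobolevConj N s) :
    (sobolevConj N s ≠ ⊤ →
      ∃ C : ℝ, 0 < C ∧ ∀ Ω : Set (Space N), ∀ lam u, IsEigenfunction Ω s q lam u →
        normLq Ω q u ≠ ⊤ → eLpNorm u ⊤ (volume.restrict Ω) ≤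
          ENNReal.ofReal (C * lam ^ ((sobolevConj N s).toReal /
            (2 * ((sobolevConj N s).toReal - q)))) * normLq Ω q u) ∧
    (sobolevConj N s = ⊤ →
      (∀ m : ℝ≥0∞, m ≠ ⊤ →
        ∃ C : ℝ, 0 < C ∧ ∀ Ω : Set (Space N), volume Ω ≤ m →
          ∀ lam u, IsEigenfunction Ω s q lam u →
            eLpNorm u ⊤ (volume.restrict Ω) ≤ ENNReal.ofReal (C * lam) * normLq Ω q u) ∧
      (∀ Ω : Set (Space N), SobolevInequality (D0 Ω s) s q →
        ∃ C : ℝ, 0 < C ∧ ∀ lam u, IsEigenfunction Ω s q lam u →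
          eLpNorm u ⊤ (volume.restrict Ω) ≤ ENNReal.ofReal (C * lam) * normLq Ω q u)) := by
  refine ⟨fun hne => ?_, fun htop => ?_⟩
  · exact exists_eLpNorm_top_le_of_two_mul_lt hN hs0 hs1 (sobolevConj_ne_top_iff.1 hne) hq1.le
      ((ENNReal.ofReal_lt_iff_lt_toReal (by linarith) hne).1 hq2)
  · obtain rfl := eq_one_of_sobolevConj_eq_top hN hs1 htop
    have hs := one_half_le_of_sobolevConj_eq_top htop
    exact ⟨fun m hm => exists_eLpNorm_top_le_mul_of_volume_le hs1 hs hq1 hm,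
      fun Ω h => h.exists_eLpNorm_top_le_mul_of_D0 hs1 hs hq1⟩

theorem mainTheorem8 (N : ℕ) (hN : 1 ≤ N) (s q : ℝ) (hs0 : 0 < s) (hs1 : s < 1)
    (hq1 : 1 < q) (hq2 : ENNReal.ofReal q < FracSemilinear.sobolevConj N s) :
    (FracSemilinear.sobolevConj N s ≠ ⊤ →
      ∃ C : ℝ, 0 < C ∧ ∀ Ω : Set (FracSemilinear.Space N), IsOpen Ω →
        FracSemilinear.CompactEmbedding Ω s q →
        ∀ lam ∈ FracSemilinear.spectrumS Ω s q, ∀ u : FracSemilinear.Space N → ℝ,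
          FracSemilinear.IsEigenfunction Ω s q lam u →
          eLpNorm u ⊤ (volume.restrict Ω) ≤
            ENNReal.ofReal (C * lam ^ ((FracSemilinear.sobolevConj N s).toReal /
              (2 * ((FracSemilinear.sobolevConj N s).toReal - q)))) *
              FracSemilinear.normLq Ω q u) ∧
    (FracSemilinear.sobolevConj N s = ⊤ →
      (∀ m : ℝ≥0∞, m ≠ ⊤ →
        ∃ C : ℝ, 0 < C ∧ ∀ Ω : Set (FracSemilinear.Space N), IsOpen Ω → volume Ω = m →
          FracSemilinear.CompactEmbedding Ω s q →
          ∀ lam ∈ FracSemilinear.spectrumS Ω s q, ∀ u : FracSemilinear.Space N → ℝ,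
            FracSemilinear.IsEigenfunction Ω s q lam u →
            eLpNorm u ⊤ (volume.restrict Ω) ≤
              ENNReal.ofReal (C * lam) * FracSemilinear.normLq Ω q u) ∧
      (∀ Ω : Set (FracSemilinear.Space N), IsOpen Ω → volume Ω = ⊤ →
        FracSemilinear.CompactEmbedding Ω s q →
        ∃ C : ℝ, 0 < C ∧
          ∀ lam ∈ FracSemilinear.spectrumS Ω s q, ∀ u : FracSemilinear.Space N → ℝ,
            FracSemilinear.IsEigenfunction Ω s q lam u →
            eLpNorm u ⊤ (volume.restrict Ω) ≤
              ENNReal.ofReal (C * lam) * FracSemilinear.normLq Ω q u)) := by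
  obtain ⟨hsub, hcrit⟩ := mainTheorem8_general N hN s q hs0 hs1 hq1 hq2
  refine ⟨fun hne => ?_, fun htop => ⟨fun m hm => ?_, fun Ω _ _ hcomp => ?_⟩⟩
  · obtain ⟨C, hC, h⟩ := hsub hne
    exact ⟨C, hC, fun Ω _ hcomp lam _ u hu => h Ω lam u hu (hcomp.1 u hu.1).2.ne⟩
  · obtain ⟨C, hC, h⟩ := (hcrit htop).1 m hm
    exact ⟨C, hC, fun Ω _ hΩ _ lam _ u hu => h Ω hΩ.le lam u hu⟩
  · obtain ⟨C, hC, h⟩ := (hcrit htop).2 Ω (hcomp.sobolevInequality hq1.le)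
    exact ⟨C, hC, fun lam _ u hu => h lam u hu⟩
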